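/- All graphs are finite, simple and connected. A \emph{cactus} is a graph $G$ in which any two distinct cycles are edge disjoint. For $u\in V(G)$ and an edge $vw$ put $d(u,vw)=\min\{d(u,v),d(u,w)\}$. A set $S\subseteq V(G)$ is a \emph{vertex} (resp. \emph{edge}) \emph{metric generator} if for every two distinct vertices (resp. edges) $x,x'$ of $G$ there is $s\in S$ with $d(s,x)\neq d(s,x')$. A \emph{thread} hanging at a vertex $v$ of degree $\geq 3$ is a path $u_1u_2\cdots u_m$ ($m\ge 1$) such that $u_1$ is a leaf, $u_2,\ldots,u_m$ have degree $2$, and $u_m$ is adjacent to $v$; its \emph{length} is $m=d(u_1,v)$. It is \emph{$S$-free} if it contains no vertex of $S$. The set $S$ is \emph{branch-resolving} if at most one $S$-free thread hangs at every vertex of degree $\ge 3$. A vertex $v$ of a cycle $C$ is \emph{$S$-active} on $C$ if the connected component of $G-E(C)$ containing $v$ contains a vertex of $S$; $a_S(C)$ is the number of $S$-active vertices on $C$, and $S$ is \emph{biactive} if $a_S(C)\ge 2$ for every cycle $C$ of $G$. Let $S$ be biactive and branch-resolving, and let $C=v_0v_1\cdots v_{g-1}$ be a cycle of length $g$ (indices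 modulo $g$), \emph{canonically labeled}, i.e. $v_0$ is $S$-active and $k=\max\{i\in[0,g-1]:v_i\text{ is }S\text{-active}\}$ is as small as possible among all labelings of $C$ that start at an $S$-active vertex. With respect to $S$, the labeled cycle $C$ contains configuration \begin{itemize} \item $\mathcal A$ if $a_S(C)=2$, $g$ is even, and $k=g/2$; \item $\mathcal B$ if $k\le\lfloor g/2\rfloor-1$ and there is an $S$-free thread hanging at $v_i$ for some $i\in[k,\lfloor g/2\rfloor-1]\cup[\lceil g/2\rceil+k+1,g-1]\cup\{0\}$; \item $\mathcal C$ if $a_S(C)=2$, $g$ is even, $k\le g/2$, and there is an $S$-free thread of length $\ge g/2-k$ hanging at $v_i$ for some $i\in[0,k]$; \item $\mathcal D$ if $k\le\lceil g/2\rceil-1$ and there is an $S$-free thread hanging at $v_i$ for some $i\in[k,\lceil g/2\rceil-1]\cup[\lfloor g/2\rfloor+k+1,g-1]\cup\{0\}$; \item $\mathcal E$ if $a_S(C)=2$ and for some $i\in[0,k]$ there is an $S$-free thread of length $\ge\lfloor g/2\rfloor-k+1$ hanging at $v_i$ and, if $g$ is even, also an $S$-free thread hanging at $v_j$ with $j=g/2+k-i$.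 \end{itemize} A cycle contains a configuration if it does so under some canonical labeling. An \emph{$S$-path} of a cycle $C$ of length $g$ is a shortest subpath of $C$ containing all $S$-active vertices of $C$. A vertex $v$ of $C$ is \emph{vertex-critical} (resp. \emph{edge-critical}) on $C$ if it is an end-vertex of an $S$-path $P$ of $C$ of length $|P|\le\lfloor g/2\rfloor-1$ (resp. $|P|\le\lceil g/2\rceil-1$). Two distinct cycles are \emph{vertex-critically} (resp. \emph{edge-critically}) \emph{incident} with respect to $S$ if they share a vertex that is vertex-critical (resp. edge-critical) on both of them. \textbf{Theorem.} Let $G$ be a cactus graph that is not a path (a single vertex counts as a path), and let $S$ be a biactive branch-resolving set in $G$. Then $S$ is a vertex (resp. an edge) metric generator of $G$ if and only if no cycle of $G$ contains any of the configurations $\mathcal A,\mathcal B,\mathcal C$ (resp. $\mathcal A,\mathcal D,\mathcal E$) with respect to $S$, and no two distinct cycles of $G$ are vertex-critically (resp. edge-critically) incident with respect to $S$. -/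

import Mathlib

namespace SimpleGraph

variable {V : Type*}

/-- The distance from the vertex `s` to the edge `e = ab`: the minimum of `d(s,a)` and `d(s,b)`. -/
noncomputable def edgeDist (G : SimpleGraph V) (s : V) (e : Sym2 V) : ℕ :=
  Sym2.lift ⟨fun a b => min (G.dist s a) (G.dist s b), fun _ _ => min_comm _ _⟩ e

/-- Every two distinct vertices are distinguished by some vertex of `S`. -/
def IsVertexMetricGenerator (G : SimpleGraph V) (S : Set V) : Prop :=
  ∀ x y : V, x ≠ y → ∃ s ∈ S, G.dist s x ≠ G.dist s y

/-- Every two distinct edges are distinguished by some vertex of `S`. -/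
def IsEdgeMetricGenerator (G : SimpleGraph V) (S : Set V) : Prop :=
  ∀ e ∈ G.edgeSet, ∀ f ∈ G.edgeSet, e ≠ f → ∃ s ∈ S, G.edgeDist s e ≠ G.edgeDist s f

/-- A cactus: a connected graph in which distinct cycles are edge disjoint. Here and below a cycle
is given by a closed walk running once around it, and two such closed walks represent the same
cycle exactly when they have the same edge set. -/
def IsCactus (G : SimpleGraph V) : Prop :=
  G.Connected ∧ ∀ (u v : V) (p : G.Walk u u) (q : G.Walk v v), p.IsCycle → q.IsCycle →
    p.edgeSet ≠ q.edgeSet → Disjoint p.edgeSet q.edgeSet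

/-- The list `l = [u₁, …, u_k]` is a thread hanging at `v`: `v` has degree at least 3, `u₁ ⋯ u_k`
is a path with at least one vertex, `u₁` is a leaf, `u₂, …, u_k` have degree 2, and `u_k` is
adjacent to `v`. -/
def IsThread (G : SimpleGraph V) [G.LocallyFinite] (v : V) (l : List V) : Prop :=
  3 ≤ G.degree v ∧ l.IsChain G.Adj ∧ l.Nodup ∧ (∃ u ∈ l.head?, G.degree u = 1) ∧
    (∀ u ∈ l.tail, G.degree u = 2) ∧ ∃ u ∈ l.getLast?, G.Adj u v

/-- A thread hanging at `v` without a vertex of `S`. -/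
def IsFreeThread (G : SimpleGraph V) [G.LocallyFinite] (S : Set V) (v : V) (l : List V) : Prop :=
  G.IsThread v l ∧ ∀ u ∈ l, u ∉ S

/-- At most one `S`-free thread hangs at every vertex (of degree at least 3). -/
def IsBranchResolving (G : SimpleGraph V) [G.LocallyFinite] (S : Set V) : Prop :=
  ∀ (v : V) (l l' : List V), G.IsFreeThread S v l → G.IsFreeThread S v l' → l = l'

/-- The vertices `v` of the cycle `p` for which the connected component of `v` in `G - E(p)`
contains a vertex of `S`. -/
def activeSet (G : SimpleGraph V) (S : Set V) {u : V} (p : G.Walk u u) : Set V :=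
  {v | v ∈ p.support ∧ ∃ s ∈ S, (G.deleteEdges p.edgeSet).Reachable v s}

/-- Every cycle has at least two `S`-active vertices. -/
def IsBiactive (G : SimpleGraph V) (S : Set V) : Prop :=
  ∀ (u : V) (p : G.Walk u u), p.IsCycle → 2 ≤ (G.activeSet S p).encard

/-- The number `k = max {i : v_i is S-active}` for the cycle `p = v_0 v_1 ⋯ v_{g-1}`, where
`v_i` is `p.getVert i` and `g` is `p.length`. -/
noncomputable def lastActive (G : SimpleGraph V) (S : Set V) {u : V} (p : G.Walk u u) : ℕ :=
  sSup {i | i < p.length ∧ p.getVert i ∈ G.activeSet S p}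

/-- `p = v_0 v_1 ⋯ v_{g-1}` is a canonical labelling of its cycle: `v_0` is `S`-active and `k` is
as small as possible among all labellings of the same cycle that start at an `S`-active vertex. -/
def IsCanonicalCycle (G : SimpleGraph V) (S : Set V) {u : V} (p : G.Walk u u) : Prop :=
  p.IsCycle ∧ u ∈ G.activeSet S p ∧
    ∀ (w : V) (q : G.Walk w w), q.IsCycle → q.edgeSet = p.edgeSet → w ∈ G.activeSet S q →
      G.lastActive S p ≤ G.lastActive S q

section Configurations

/-! The configurations, for a canonically labelled cycle `p` of length `g = p.length` and
`k = G.lastActive S p`. In natural numbers `⌊g/2⌋` is `g / 2` and `⌈g/2⌉` is `(g + 1) / 2`;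
inequalities are written without subtraction. The length of a thread `u₁ ⋯ u_k` hanging at `v` is
the distance from the leaf `u₁` to `v`, i.e. the number of its vertices. -/

/-- `a_S(C) = 2`, `g` is even and `k = g/2`. -/
def ConfigA (G : SimpleGraph V) (S : Set V) {u : V} (p : G.Walk u u) : Prop :=
  (G.activeSet S p).encard = 2 ∧ Even p.length ∧ G.lastActive S p = p.length / 2

/-- `k ≤ ⌊g/2⌋ - 1` and an `S`-free thread hangs at some `v_i` with
`i ∈ [k, ⌊g/2⌋ - 1] ∪ [⌈g/2⌉ + k + 1, g - 1] ∪ {0}`. -/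
def ConfigB (G : SimpleGraph V) [G.LocallyFinite] (S : Set V) {u : V} (p : G.Walk u u) : Prop :=
  G.lastActive S p + 1 ≤ p.length / 2 ∧
    ∃ i : ℕ, ((G.lastActive S p ≤ i ∧ i + 1 ≤ p.length / 2) ∨
        ((p.length + 1) / 2 + G.lastActive S p + 1 ≤ i ∧ i + 1 ≤ p.length) ∨ i = 0) ∧
      ∃ l, G.IsFreeThread S (p.getVert i) l

/-- `a_S(C) = 2`, `g` is even, `k ≤ g/2` and an `S`-free thread of length at least `g/2 - k` hangs
at some `v_i` with `i ∈ [0, k]`. -/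
def ConfigC (G : SimpleGraph V) [G.LocallyFinite] (S : Set V) {u : V} (p : G.Walk u u) : Prop :=
  (G.activeSet S p).encard = 2 ∧ Even p.length ∧ G.lastActive S p ≤ p.length / 2 ∧
    ∃ i ≤ G.lastActive S p, ∃ l, G.IsFreeThread S (p.getVert i) l ∧
      p.length / 2 ≤ l.length + G.lastActive S p

/-- `k ≤ ⌈g/2⌉ - 1` and an `S`-free thread hangs at some `v_i` with
`i ∈ [k, ⌈g/2⌉ - 1] ∪ [⌊g/2⌋ + k + 1, g - 1] ∪ {0}`. -/
def ConfigD (G : SimpleGraph V) [G.LocallyFinite] (S : Set V) {u : V} (p : G.Walk u u) : Prop :=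
  G.lastActive S p + 1 ≤ (p.length + 1) / 2 ∧
    ∃ i : ℕ, ((G.lastActive S p ≤ i ∧ i + 1 ≤ (p.length + 1) / 2) ∨
        (p.length / 2 + G.lastActive S p + 1 ≤ i ∧ i + 1 ≤ p.length) ∨ i = 0) ∧
      ∃ l, G.IsFreeThread S (p.getVert i) l

/-- `a_S(C) = 2` and an `S`-free thread of length at least `⌊g/2⌋ - k + 1` hangs at some `v_i` with
`i ∈ [0, k]`; moreover, if `g` is even, an `S`-free thread hangs at `v_j` with `j = g/2 + k - i`. -/
def ConfigE (G : SimpleGraph V) [G.LocallyFinite] (S : Set V) {u : V} (p : G.Walk u u) : Prop :=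
  (G.activeSet S p).encard = 2 ∧
    ∃ i ≤ G.lastActive S p,
      (∃ l, G.IsFreeThread S (p.getVert i) l ∧
        p.length / 2 + 1 ≤ l.length + G.lastActive S p) ∧
      (Even p.length →
        ∃ l, G.IsFreeThread S (p.getVert (p.length / 2 + G.lastActive S p - i)) l)

end Configurations

/-- The walk `P` is a subpath of the cycle `p` that contains all `S`-active vertices of `p`. -/
def IsActivePath (G : SimpleGraph V) (S : Set V) {u : V} (p : G.Walk u u) {a b : V}
    (P : G.Walk a b) : Prop :=
  P.IsPath ∧ P.edgeSet ⊆ p.edgeSet ∧ (∀ v ∈ P.support, v ∈ p.support) ∧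
    ∀ v ∈ G.activeSet S p, v ∈ P.support

/-- `P` is an `S`-path of the cycle `p`: a shortest subpath of `p` containing all `S`-active
vertices of `p`. -/
def IsSPath (G : SimpleGraph V) (S : Set V) {u : V} (p : G.Walk u u) {a b : V}
    (P : G.Walk a b) : Prop :=
  G.IsActivePath S p P ∧
    ∀ (c d : V) (Q : G.Walk c d), G.IsActivePath S p Q → P.length ≤ Q.length

/-- `v` is an end-vertex of an `S`-path of `p` of length at most `⌊g/2⌋ - 1`. -/
def IsVertexCritical (G : SimpleGraph V) (S : Set V) {u : V} (p : G.Walk u u) (v : V) : Prop :=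
  ∃ (a b : V) (P : G.Walk a b), G.IsSPath S p P ∧ (v = a ∨ v = b) ∧ P.length + 1 ≤ p.length / 2

/-- `v` is an end-vertex of an `S`-path of `p` of length at most `⌈g/2⌉ - 1`. -/
def IsEdgeCritical (G : SimpleGraph V) (S : Set V) {u : V} (p : G.Walk u u) (v : V) : Prop :=
  ∃ (a b : V) (P : G.Walk a b), G.IsSPath S p P ∧ (v = a ∨ v = b) ∧
    P.length + 1 ≤ (p.length + 1) / 2

/-- The cycles `p` and `q` are distinct and share a vertex that is vertex-critical on both. -/
def VertexCriticallyIncident (G : SimpleGraph V) (S : Set V) {u w : V} (p : G.Walk u u)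
    (q : G.Walk w w) : Prop :=
  p.edgeSet ≠ q.edgeSet ∧ ∃ v, v ∈ p.support ∧ v ∈ q.support ∧
    G.IsVertexCritical S p v ∧ G.IsVertexCritical S q v

/-- The cycles `p` and `q` are distinct and share a vertex that is edge-critical on both. -/
def EdgeCriticallyIncident (G : SimpleGraph V) (S : Set V) {u w : V} (p : G.Walk u u)
    (q : G.Walk w w) : Prop :=
  p.edgeSet ≠ q.edgeSet ∧ ∃ v, v ∈ p.support ∧ v ∈ q.support ∧
    G.IsEdgeCritical S p v ∧ G.IsEdgeCritical S q v

end SimpleGraph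

/-!
Call an edge `wb` *free* at `w` when it leads away from every `s ∈ S`: in the vertex version
`d(s, b) = d(s, w) + 1`, in the edge version `d(s, b) ≥ d(s, w)`. If two edges are free at `w`,
then `S` does not distinguish their other ends (resp. the edges themselves). Such a free pair
exists exactly when some cycle contains `ℬ` (resp. `𝒟`) or two cycles are critically incident:
since `S` is biactive and branch-resolving, an edge free at `w` either lies on a cycle whose active
vertices are all on a short arc ending at `w`, or starts an `S`-free thread, and at most one such
thread hangs at `w`.

For two arbitrary undistinguished objects, a cycle `C` enters the distances only through *gates*,
the vertices of `C` nearest to the object `x` and to `s ∈ S`: if these differ, then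
`d(s, x) = d(s, gate s) + d_C(gate s, gate x) + d(gate x, x)`. If some cycle separates the gates of
the two objects, comparing the distances from two active gates shows that there is a free pair, or
that `C` has only two active vertices, and they are in balance between the two objects; the balance
is `𝒜`, `𝒞` or `ℰ`. If no cycle separates them, the two objects branch off from each other along
bridges, and the first two edges of the branches are a free pair.
-/

namespace Cactus

open SimpleGraph

variable {V : Type*} {G : SimpleGraph V} {S : Set V} {κ : ℕ}

/-! ### Distances and walks -/

section Distance

variable {a b s x : V}

lemma apply_le_apply_add_length {F : V → ℕ} (hF : ∀ z z', G.Adj z z' → F z' ≤ F z + 1)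
    (p : G.Walk a b) : F b ≤ F a + p.length := by
  induction p with
  | nil => simp
  | cons h p ih =>
    have := hF _ _ h
    simp only [Walk.length_cons]
    omega

lemma apply_le_apply_add_dist (hG : G.Connected) {F : V → ℕ}
    (hF : ∀ z z', G.Adj z z' → F z' ≤ F z + 1) (a b : V) : F b ≤ F a + G.dist a b := by
  obtain ⟨p, hp⟩ := hG.exists_walk_length_eq_dist a b
  exact hp ▸ apply_le_apply_add_length hF p

lemma dist_le_dist_add_one (hG : G.Connected) (x : V) (h : G.Adj a b) :
    G.dist x b ≤ G.dist x a + 1 :=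
  hG.dist_triangle.trans_eq (by rw [dist_eq_one_iff_adj.mpr h])

lemma exists_adj_dist_add_one (hG : G.Connected) (h : a ≠ x) :
    ∃ b, G.Adj a b ∧ G.dist b x + 1 = G.dist a x := by
  obtain ⟨p, hp⟩ := hG.exists_walk_length_eq_dist a x
  cases p with
  | nil => exact absurd rfl h
  | cons hadj q =>
    refine ⟨_, hadj, ?_⟩
    have hq := G.dist_le q
    have hstep := dist_le_dist_add_one hG x hadj.symm
    rw [dist_comm, dist_comm (u := x)] at hstep
    simp only [Walk.length_cons] at hp
    omega

lemma dist_eq_add_of_forall_mem_support (hG : G.Connected)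
    (h : ∀ q : G.Walk s x, a ∈ q.support) : G.dist s x = G.dist s a + G.dist a x := by
  classical
  refine le_antisymm hG.dist_triangle ?_
  obtain ⟨q, hq⟩ := hG.exists_walk_length_eq_dist s x
  rw [← hq, ← q.take_spec (h q), Walk.length_append]
  exact add_le_add (G.dist_le _) (G.dist_le _)

lemma exists_exit_of_not_reachable {E : Set (Sym2 V)} (h : ¬ (G.deleteEdges E).Reachable s x)
    (q : G.Walk s x) :
    ∃ z ∈ q.support, ∃ z', G.Adj z z' ∧ s(z, z') ∈ E ∧ (G.deleteEdges E).Reachable s z := by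
  obtain ⟨d, hd, hfst, hsnd⟩ :=
    q.exists_boundary_dart {z | (G.deleteEdges E).Reachable s z} (Reachable.refl s) h
  refine ⟨d.fst, q.dart_fst_mem_support_of_mem_darts hd, d.snd, d.adj, ?_, hfst⟩
  by_contra he
  exact hsnd (hfst.trans (deleteEdges_adj.mpr ⟨d.adj, he⟩).reachable)

lemma dist_getVert_le (p : G.Walk a b) (i j : ℕ) :
    G.dist (p.getVert i) (p.getVert j) ≤ (i - j) + (j - i) := by
  wlog hij : i ≤ j generalizing i j
  · rw [dist_comm, add_comm]
    exact this j i (by omega)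
  have hle := G.dist_le (((p.drop i).take (j - i)).copy rfl
    (by rw [p.drop_getVert, Nat.add_sub_cancel' hij]))
  rw [Walk.length_copy, Walk.take_length] at hle
  omega

lemma dist_le_length_of_mem_support {p : G.Walk a b} (hs : s ∈ p.support) (hx : x ∈ p.support) :
    G.dist s x ≤ p.length := by
  obtain ⟨i, rfl, hi⟩ := Walk.mem_support_iff_exists_getVert.mp hs
  obtain ⟨j, rfl, hj⟩ := Walk.mem_support_iff_exists_getVert.mp hx
  have := dist_getVert_le p i j
  omega

lemma reachable_getVert {H : SimpleGraph V} (p : G.Walk a b) {i j : ℕ} (hij : i ≤ j)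
    (hH : ∀ t, i ≤ t → t < j → H.Adj (p.getVert t) (p.getVert (t + 1))) :
    H.Reachable (p.getVert i) (p.getVert j) := by
  induction j, hij using Nat.le_induction with
  | base => exact Reachable.refl _
  | succ j hij ih =>
    exact (ih fun t h1 h2 => hH t h1 (by omega)).trans (hH j hij (by omega)).reachable

lemma edge_getVert_mem (p : G.Walk a b) {i : ℕ} (hi : i < p.length) :
    s(p.getVert i, p.getVert (i + 1)) ∈ p.edgeSet :=
  (p.mk_mem_edges_iff_exists).mpr ⟨i, hi, rfl⟩

end Distance

/-! ### Positions on a cycle -/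

section Positions

variable {u : V} {p : G.Walk u u}

lemma getVert_inj (hp : p.IsCycle) {i j : ℕ} (hi : i < p.length) (hj : j < p.length)
    (h : p.getVert i = p.getVert j) : i = j :=
  hp.getVert_injOn' (Nat.le_sub_one_of_lt hi) (Nat.le_sub_one_of_lt hj) h

lemma edge_getVert_inj (hp : p.IsCycle) {i j : ℕ} (hi : i < p.length) (hj : j < p.length)
    (h : s(p.getVert i, p.getVert (i + 1)) = s(p.getVert j, p.getVert (j + 1))) : i = j := by
  rw [← p.length_edges] at hi hj
  rw [← Walk.getElem_edges hi, ← Walk.getElem_edges hj] at h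
  exact hp.edges_nodup.getElem_inj_iff.mp h

lemma exists_getVert_eq (hp : p.IsCycle) {v : V} (hv : v ∈ p.support) :
    ∃ i < p.length, p.getVert i = v := by
  obtain ⟨i, rfl, hi⟩ := Walk.mem_support_iff_exists_getVert.mp hv
  have := hp.three_le_length
  rcases hi.lt_or_eq with h | rfl
  · exact ⟨i, h, rfl⟩
  · exact ⟨0, by omega, by simp⟩

lemma mem_support_iff_exists_mem_edgeSet (hp : p.IsCycle) {v : V} :
    v ∈ p.support ↔ ∃ e ∈ p.edgeSet, v ∈ e :=
  Walk.mem_support_iff_exists_mem_edges_of_not_nil hp.not_nil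

lemma eq_getVert_or_eq_getVert_of_edge_mem (hp : p.IsCycle) {i : ℕ} (hi : i + 1 < p.length) {y : V}
    (h : s(p.getVert (i + 1), y) ∈ p.edgeSet) : y = p.getVert i ∨ y = p.getVert (i + 2) := by
  obtain ⟨j, hj, he⟩ := p.mk_mem_edges_iff_exists.mp h
  rcases Sym2.eq_iff.mp he with ⟨h1, h2⟩ | ⟨h1, h2⟩
  · obtain rfl := getVert_inj hp hj hi h1
    exact Or.inr h2.symm
  · left
    rcases (Nat.succ_le_of_lt hj).lt_or_eq with hj' | hj'
    · obtain rfl : j = i := by simpa using getVert_inj hp hj' hi h2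
      exact h1.symm
    · have hlast : p.getVert 0 = p.getVert (i + 1) := by
        rw [p.getVert_zero, ← h2]
        exact (hj' ▸ p.getVert_length).symm
      exact absurd (getVert_inj hp (by omega) hi hlast) (by omega)

lemma exists_isCycle_getVert (hp : p.IsCycle) {j : ℕ} (hj : j < p.length) :
    ∃ q : G.Walk (p.getVert j) (p.getVert j), q.IsCycle ∧ q.edgeSet = p.edgeSet ∧
      q.length = p.length ∧ (∀ i, i + j ≤ p.length → q.getVert i = p.getVert (i + j)) ∧
      ∀ i, p.length ≤ i + j → i ≤ p.length → q.getVert i = p.getVert (i + j - p.length) := by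
  classical
  have hmem : p.getVert j ∈ p.support := p.getVert_mem_support j
  have hidx : p.support.idxOf (p.getVert j) = j := by
    have hle : p.support.idxOf (p.getVert j) ≤ j := by
      by_contra! hlt
      rw [p.getVert_eq_support_getElem hj.le] at hlt
      simpa using List.not_of_lt_findIdx hlt
    exact getVert_inj hp (hle.trans_lt hj) hj (p.getVert_support_idxOf hmem)
  have hrotate : ∀ i, (p.rotate _ hmem).getVert i =
      if i < p.length - j then p.getVert (j + i)
      else (p.takeUntil _ hmem).getVert (i - (p.length - j)) := fun i => by
    rw [Walk.rotate, Walk.getVert_append, Walk.length_dropUntil, hidx, Walk.dropUntil_eq_drop,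
      Walk.getVert_copy, Walk.drop_getVert, hidx]
  have htake : ∀ i ≤ j, (p.takeUntil _ hmem).getVert i = p.getVert i := fun i hi =>
    Walk.getVert_takeUntil hmem (by rwa [Walk.length_takeUntil, hidx])
  refine ⟨p.rotate _ hmem, hp.rotate hmem, ?_, p.length_rotate _ _, fun i hi => ?_,
    fun i hi hi' => ?_⟩
  · ext e
    exact (p.rotate_edges _ hmem).mem_iff
  · rw [hrotate]
    split_ifs with h
    · rw [add_comm]
    · rw [htake _ (by omega), show i - (p.length - j) = 0 by omega, p.getVert_zero,
        show i + j = p.length by omega, p.getVert_length]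
  · rw [hrotate, if_neg (by omega), htake _ (by omega)]
    congr 1
    omega

end Positions

/-! ### Cycles through an edge -/

section CycleThroughEdge

variable {a b u w : V}

lemma exists_isCycle_of_not_isBridge (hadj : G.Adj a b) (h : ¬ G.IsBridge s(a, b)) :
    ∃ p : G.Walk a a, p.IsCycle ∧ p.getVert 1 = b := by
  classical
  rw [isBridge_iff, not_not] at h
  obtain ⟨q⟩ := h.symm
  have hle : G.deleteEdges {s(a, b)} ≤ G := deleteEdges_le _
  refine ⟨Walk.cons hadj (q.toPath.1.mapLe hle), ?_, by simp⟩
  refine Walk.cons_isCycle_iff _ _ |>.mpr ⟨(Walk.isPath_mapLe hle).mpr q.toPath.2, fun hmem => ?_⟩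
  rw [Walk.edges_mapLe_eq_edges] at hmem
  simpa using q.toPath.1.edges_subset_edgeSet hmem

lemma exists_isCycle_penultimate_eq (hadj : G.Adj a b) (h : ¬ G.IsBridge s(a, b)) :
    ∃ p : G.Walk a a, p.IsCycle ∧ p.penultimate = b := by
  obtain ⟨p, hp, hb⟩ := exists_isCycle_of_not_isBridge hadj h
  exact ⟨p.reverse, hp.reverse, by rw [p.penultimate_reverse, ← hb]⟩

lemma edgeSet_eq_of_mem (hG : G.IsCactus) {p : G.Walk u u} {q : G.Walk w w} (hp : p.IsCycle)
    (hq : q.IsCycle) {e : Sym2 V} (hep : e ∈ p.edgeSet) (heq : e ∈ q.edgeSet) :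
    p.edgeSet = q.edgeSet := by
  by_contra h
  exact Set.disjoint_left.mp (hG.2 u w p q hp hq h) hep heq

lemma not_reachable_getVert (hG : G.IsCactus) {p : G.Walk u u} (hp : p.IsCycle) {i j : ℕ}
    (hij : i < j) (hj : j < p.length) :
    ¬ (G.deleteEdges p.edgeSet).Reachable (p.getVert i) (p.getVert j) := by
  intro hr
  set e := s(p.getVert i, p.getVert (i + 1)) with he
  set f := s(p.getVert j, p.getVert (j + 1))
  have hne {t t' : ℕ} (ht : t < p.length) (ht' : t' < p.length) (h : t ≠ t') :
      s(p.getVert t, p.getVert (t + 1)) ≠ s(p.getVert t', p.getVert (t' + 1)) :=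
    fun heq => h (edge_getVert_inj hp ht ht' heq)
  have hle : G.deleteEdges {f} ≤ G := deleteEdges_le _
  have hadj : (G.deleteEdges {f}).Adj (p.getVert i) (p.getVert (i + 1)) :=
    deleteEdges_adj.mpr ⟨p.adj_getVert_succ (by omega), hne (by omega) hj (by omega)⟩
  have hback : (G.deleteEdges ({f} ∪ {e})).Reachable (p.getVert (i + 1)) (p.getVert j) := by
    refine reachable_getVert p (by omega) fun t h1 h2 => ?_
    refine deleteEdges_adj.mpr ⟨p.adj_getVert_succ (by omega), ?_⟩
    rintro (h | h)
    · exact hne (by omega) hj (by omega) h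
    · exact hne (by omega) (by omega) (by omega) h
  have hnb : ¬ (G.deleteEdges {f}).IsBridge e := by
    rw [he, isBridge_iff, not_not, deleteEdges_deleteEdges]
    refine (hr.mono (deleteEdges_anti ?_)).trans hback.symm
    rintro x (rfl | rfl)
    · exact edge_getVert_mem p hj
    · exact edge_getVert_mem p (by omega)
  obtain ⟨c, hc, hc1⟩ := exists_isCycle_of_not_isBridge hadj hnb
  have hce : e ∈ (c.mapLe hle).edgeSet := by
    rw [Walk.edgeSet_mapLe_eq_edgeSet]
    simpa [hc1] using edge_getVert_mem c (i := 0) (by have := hc.three_le_length; omega)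
  have hcf : f ∈ c.edgeSet := by
    rw [← Walk.edgeSet_mapLe_eq_edgeSet hle, edgeSet_eq_of_mem hG ((Walk.isCycle_mapLe hle).mpr hc)
      hp hce (edge_getVert_mem p (by omega))]
    exact edge_getVert_mem p hj
  simpa using c.edges_subset_edgeSet hcf

end CycleThroughEdge

/-! ### Gates -/

/-- The distance of the positions `i` and `j` on a cycle of length `g`. -/
def cycDist (g i j : ℕ) : ℕ := min (i - j + (j - i)) (g - (i - j + (j - i)))

/-- The position on the cycle `p` of the gate of `x`: the vertex of `p` that lies in the component
of `x` in `G - E(p)`, through which every path from `x` enters `p`. -/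
noncomputable def gateIdx {u : V} (p : G.Walk u u) (x : V) : ℕ :=
  sInf {i | (G.deleteEdges p.edgeSet).Reachable (p.getVert i) x}

section Gate

variable {u : V} {p : G.Walk u u}

lemma exists_reachable_getVert (hG : G.Connected) (hp : p.IsCycle) (x : V) :
    ∃ i < p.length, (G.deleteEdges p.edgeSet).Reachable (p.getVert i) x := by
  by_cases hx : (G.deleteEdges p.edgeSet).Reachable x u
  · exact ⟨0, by have := hp.three_le_length; omega, by simpa using hx.symm⟩
  · obtain ⟨q⟩ := hG.preconnected x u
    obtain ⟨z, -, z', -, he, hz⟩ := exists_exit_of_not_reachable hx q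
    obtain ⟨i, hi, rfl⟩ := exists_getVert_eq hp
      (p.fst_mem_support_of_mem_edges he)
    exact ⟨i, hi, hz.symm⟩

lemma reachable_gateIdx (hG : G.Connected) (hp : p.IsCycle) (x : V) :
    (G.deleteEdges p.edgeSet).Reachable (p.getVert (gateIdx p x)) x := by
  obtain ⟨i, -, hi⟩ := exists_reachable_getVert hG hp x
  exact Nat.sInf_mem (s := {i | (G.deleteEdges p.edgeSet).Reachable (p.getVert i) x}) ⟨i, hi⟩

lemma gateIdx_lt (hG : G.Connected) (hp : p.IsCycle) (x : V) : gateIdx p x < p.length := by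
  obtain ⟨i, hi, h⟩ := exists_reachable_getVert hG hp x
  exact (Nat.sInf_le (by exact h)).trans_lt hi

lemma gateIdx_eq (hG : G.IsCactus) (hp : p.IsCycle) {x : V} {i : ℕ} (hi : i < p.length)
    (h : (G.deleteEdges p.edgeSet).Reachable (p.getVert i) x) : gateIdx p x = i := by
  have hgate := reachable_gateIdx hG.1 hp x
  rcases lt_trichotomy (gateIdx p x) i with h' | h' | h'
  · exact absurd (hgate.trans h.symm) (not_reachable_getVert hG hp h' hi)
  · exact h'
  · exact absurd (h.trans hgate.symm) (not_reachable_getVert hG hp h' (gateIdx_lt hG.1 hp x))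

lemma gateIdx_getVert (hG : G.IsCactus) (hp : p.IsCycle) {i : ℕ} (hi : i < p.length) :
    gateIdx p (p.getVert i) = i :=
  gateIdx_eq hG hp hi (Reachable.refl _)

lemma getVert_gateIdx (hG : G.IsCactus) (hp : p.IsCycle) {v : V} (hv : v ∈ p.support) :
    p.getVert (gateIdx p v) = v := by
  obtain ⟨i, hi, rfl⟩ := exists_getVert_eq hp hv
  rw [gateIdx_getVert hG hp hi]

lemma gateIdx_eq_of_reachable (hG : G.IsCactus) (hp : p.IsCycle) {x y : V}
    (h : (G.deleteEdges p.edgeSet).Reachable x y) : gateIdx p x = gateIdx p y :=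
  (gateIdx_eq hG hp (gateIdx_lt hG.1 hp x) ((reachable_gateIdx hG.1 hp x).trans h)).symm

lemma gateIdx_eq_of_adj (hG : G.IsCactus) (hp : p.IsCycle) {x y : V} (hadj : G.Adj x y)
    (h : s(x, y) ∉ p.edgeSet) : gateIdx p x = gateIdx p y :=
  gateIdx_eq_of_reachable hG hp (deleteEdges_adj.mpr ⟨hadj, h⟩).reachable

lemma dist_getVert_le_cycDist (p : G.Walk u u) {i j : ℕ} (hi : i ≤ p.length) (hj : j ≤ p.length) :
    G.dist (p.getVert i) (p.getVert j) ≤ cycDist p.length i j := by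
  wlog hij : i ≤ j generalizing i j
  · have := this hj hi (by omega)
    rw [dist_comm]
    simp only [cycDist] at *
    omega
  refine le_min (dist_getVert_le p i j) ?_
  have hle := G.dist_le ((p.drop j).append (p.take i))
  rw [Walk.length_append, p.drop_length, p.take_length, dist_comm] at hle
  omega

lemma gateIdx_getVert_eq_or (hG : G.IsCactus) (hp : p.IsCycle) {i : ℕ} (hi : i ≤ p.length) :
    gateIdx p (p.getVert i) = i ∨ i = p.length ∧ gateIdx p (p.getVert i) = 0 := by
  rcases hi.lt_or_eq with h | rfl
  · exact Or.inl (gateIdx_getVert hG hp h)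
  · refine Or.inr ⟨rfl, ?_⟩
    rw [p.getVert_length]
    simpa using gateIdx_getVert hG hp (i := 0) (by have := hp.three_le_length; omega)

lemma cycDist_gateIdx_le_dist (hG : G.IsCactus) (hp : p.IsCycle) (x y : V) :
    cycDist p.length (gateIdx p x) (gateIdx p y) ≤ G.dist x y := by
  have hx := gateIdx_lt hG.1 hp x
  have hstep : ∀ z z', G.Adj z z' → cycDist p.length (gateIdx p x) (gateIdx p z') ≤
      cycDist p.length (gateIdx p x) (gateIdx p z) + 1 := by
    intro z z' hadj
    by_cases he : s(z, z') ∈ p.edgeSet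
    · obtain ⟨i, hi, h⟩ := p.mk_mem_edges_iff_exists.mp he
      have h1 := gateIdx_getVert hG hp hi
      have h2 := gateIdx_getVert_eq_or hG hp (Nat.succ_le_of_lt hi)
      rcases Sym2.eq_iff.mp h with ⟨rfl, rfl⟩ | ⟨rfl, rfl⟩ <;>
      · simp only [cycDist, Nat.succ_eq_add_one] at *
        omega
    · rw [gateIdx_eq_of_adj hG hp hadj he]
      exact Nat.le_succ _
  have := apply_le_apply_add_dist hG.1 hstep x y
  simpa [cycDist] using this

lemma dist_getVert_getVert (hG : G.IsCactus) (hp : p.IsCycle) {i j : ℕ} (hi : i < p.length)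
    (hj : j ≤ p.length) : G.dist (p.getVert i) (p.getVert j) = cycDist p.length i j := by
  refine (dist_getVert_le_cycDist p hi.le hj).antisymm ?_
  have hle := cycDist_gateIdx_le_dist hG hp (p.getVert i) (p.getVert j)
  rw [gateIdx_getVert hG hp hi] at hle
  have := gateIdx_getVert_eq_or hG hp hj
  simp only [cycDist] at *
  omega

lemma dist_eq_of_gateIdx_ne (hG : G.IsCactus) (hp : p.IsCycle) {s x : V}
    (h : gateIdx p s ≠ gateIdx p x) :
    G.dist s x = G.dist s (p.getVert (gateIdx p x)) + G.dist (p.getVert (gateIdx p x)) x := by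
  refine dist_eq_add_of_forall_mem_support hG.1 fun q => ?_
  have hnr : ¬ (G.deleteEdges p.edgeSet).Reachable x s :=
    fun hr => h (gateIdx_eq_of_reachable hG hp hr).symm
  obtain ⟨z, hz, z', -, he, hr⟩ := exists_exit_of_not_reachable hnr q.reverse
  have hzp := p.fst_mem_support_of_mem_edges he
  rw [gateIdx_eq_of_reachable hG hp hr, getVert_gateIdx hG hp hzp]
  simpa using hz

lemma dist_getVert (hG : G.IsCactus) (hp : p.IsCycle) (s : V) {j : ℕ} (hj : j ≤ p.length) :
    G.dist s (p.getVert j) =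
      G.dist s (p.getVert (gateIdx p s)) + cycDist p.length (gateIdx p s) j := by
  rw [← dist_getVert_getVert hG hp (gateIdx_lt hG.1 hp s) hj]
  by_cases h : gateIdx p (p.getVert j) = gateIdx p s
  · rw [← h, getVert_gateIdx hG hp (p.getVert_mem_support j), dist_self, add_zero]
  · rw [dist_comm, dist_eq_of_gateIdx_ne hG hp h, add_comm, dist_comm (v := s),
      dist_comm (u := p.getVert j)]

end Gate

/-! ### Active vertices -/

section Active

variable {u : V} {p : G.Walk u u}

lemma activeSet_eq_of_edgeSet_eq {w : V} {q : G.Walk w w} (hp : p.IsCycle) (hq : q.IsCycle)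
    (h : q.edgeSet = p.edgeSet) : G.activeSet S q = G.activeSet S p := by
  ext v
  simp only [activeSet, Set.mem_ofPred_eq, mem_support_iff_exists_mem_edgeSet hp,
    mem_support_iff_exists_mem_edgeSet hq, h]

lemma getVert_mem_activeSet_iff (hG : G.IsCactus) (hp : p.IsCycle) {i : ℕ} (hi : i < p.length) :
    p.getVert i ∈ G.activeSet S p ↔ ∃ s ∈ S, gateIdx p s = i := by
  constructor
  · rintro ⟨-, s, hs, hr⟩
    exact ⟨s, hs, gateIdx_eq hG hp hi hr⟩
  · rintro ⟨s, hs, rfl⟩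
    exact ⟨p.getVert_mem_support _, s, hs, reachable_gateIdx hG.1 hp s⟩

lemma getVert_gateIdx_mem_activeSet (hG : G.Connected) (hp : p.IsCycle) {s : V} (hs : s ∈ S) :
    p.getVert (gateIdx p s) ∈ G.activeSet S p :=
  ⟨p.getVert_mem_support _, s, hs, reachable_gateIdx hG hp s⟩

lemma exists_gateIdx_ne (hG : G.IsCactus) (hbi : G.IsBiactive S) (hp : p.IsCycle) (i : ℕ) :
    ∃ s ∈ S, gateIdx p s ≠ i := by
  by_contra! h
  have hsub : G.activeSet S p ⊆ {p.getVert i} := by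
    rintro v ⟨hv, s, hs, hr⟩
    obtain ⟨j, hj, rfl⟩ := exists_getVert_eq hp hv
    rw [Set.mem_singleton_iff, ← h s hs, gateIdx_eq hG hp hj hr]
  have hone := (Set.encard_le_encard hsub).trans_eq (Set.encard_singleton _)
  exact absurd ((hbi u p hp).trans hone) (by norm_num)

lemma le_lastActive {i : ℕ} (hi : i < p.length) (h : p.getVert i ∈ G.activeSet S p) :
    i ≤ G.lastActive S p :=
  le_csSup ⟨p.length, fun _ hj => hj.1.le⟩ ⟨hi, h⟩

lemma lastActive_mem (hp : p.IsCycle) (h : (G.activeSet S p).Nonempty) :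
    G.lastActive S p < p.length ∧ p.getVert (G.lastActive S p) ∈ G.activeSet S p := by
  obtain ⟨v, hv⟩ := h
  obtain ⟨i, hi, rfl⟩ := exists_getVert_eq hp hv.1
  exact Nat.sSup_mem (s := {i | i < p.length ∧ p.getVert i ∈ G.activeSet S p}) ⟨i, hi, hv⟩
    ⟨p.length, fun _ hj => hj.1.le⟩

lemma gateIdx_le_lastActive (hG : G.Connected) (hp : p.IsCycle) {s : V} (hs : s ∈ S) :
    gateIdx p s ≤ G.lastActive S p :=
  le_lastActive (gateIdx_lt hG hp s) (getVert_gateIdx_mem_activeSet hG hp hs)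

lemma lastActive_le {k : ℕ} (hp : p.IsCycle) (h : (G.activeSet S p).Nonempty)
    (hk : ∀ i < p.length, p.getVert i ∈ G.activeSet S p → i ≤ k) : G.lastActive S p ≤ k :=
  hk _ (lastActive_mem hp h).1 (lastActive_mem hp h).2

lemma isCanonicalCycle_of_two_mul_lastActive_le (hG : G.IsCactus) (hp : p.IsCycle)
    (hu : u ∈ G.activeSet S p) (hk : 2 * G.lastActive S p ≤ p.length) :
    G.IsCanonicalCycle S p := by
  refine ⟨hp, hu, fun w q hq hqp _ => ?_⟩
  obtain ⟨hlt, hmem⟩ := lastActive_mem hp ⟨u, hu⟩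
  -- `v_0` and `v_k` are active at distance `k`, whatever the labelling `q`.
  have hdist := dist_getVert_getVert hG hp (i := 0) (by have := hp.three_le_length; omega) hlt.le
  rw [p.getVert_zero] at hdist
  rw [← activeSet_eq_of_edgeSet_eq (S := S) hp hq hqp] at hu hmem
  obtain ⟨i, hi, hiu⟩ := exists_getVert_eq hq hu.1
  obtain ⟨j, hj, hjk⟩ := exists_getVert_eq hq hmem.1
  have hile := le_lastActive hi (by rwa [hiu])
  have hjle := le_lastActive hj (by rwa [hjk])
  have hij := dist_getVert_le q i j
  rw [hiu, hjk, hdist, cycDist] at hij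
  omega

end Active

/-! ### Bridges -/

/-- The side of `b` of an edge `ab`: the component of `b` in `G - ab`. -/
def side (G : SimpleGraph V) (a b : V) : Set V := {x | (G.deleteEdges {s(a, b)}).Reachable b x}

section Bridge

variable {a b c s x y : V}

lemma mem_side_self (a b : V) : b ∈ side G a b := Reachable.refl _

lemma mem_side_of_adj (hx : x ∈ side G a b) (hadj : G.Adj x y) (hne : s(x, y) ≠ s(a, b)) :
    y ∈ side G a b :=
  hx.trans (deleteEdges_adj.mpr ⟨hadj, hne⟩).reachable

lemma mem_side_swap : x ∈ side G b a ↔ (G.deleteEdges {s(a, b)}).Reachable a x := by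
  rw [side, Set.mem_ofPred_eq, Sym2.eq_swap]

lemma isBridge_symm (hb : G.IsBridge s(a, b)) : G.IsBridge s(b, a) := Sym2.eq_swap ▸ hb

lemma notMem_side (hb : G.IsBridge s(a, b)) (hx : x ∈ side G b a) : x ∉ side G a b :=
  fun h => isBridge_iff.mp hb ((mem_side_swap.mp hx).trans h.symm)

lemma mem_side_or_mem_side (hG : G.Connected) (a b x : V) : x ∈ side G b a ∨ x ∈ side G a b := by
  by_contra! h
  obtain ⟨q⟩ := hG.preconnected x a
  obtain ⟨z, -, z', -, he, hz⟩ :=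
    exists_exit_of_not_reachable (fun hr => h.1 (mem_side_swap.mpr hr.symm)) q
  rcases Sym2.eq_iff.mp he with ⟨rfl, -⟩ | ⟨rfl, -⟩
  · exact h.1 (mem_side_swap.mpr hz.symm)
  · exact h.2 hz.symm

lemma adj_of_isBridge (hG : G.Connected) (hb : G.IsBridge s(a, b)) : G.Adj a b := by
  obtain ⟨q⟩ := hG.preconnected a b
  obtain ⟨z, -, z', hadj, he, -⟩ := exists_exit_of_not_reachable (isBridge_iff.mp hb) q
  rwa [← mem_edgeSet, ← Set.mem_singleton_iff.mp he]

lemma mem_support_of_isBridge (hb : G.IsBridge s(a, b)) (hs : s ∈ side G b a)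
    (hx : x ∈ side G a b) (q : G.Walk s x) : a ∈ q.support := by
  have hsx : ¬ (G.deleteEdges {s(a, b)}).Reachable s x := fun hr =>
    notMem_side hb hs (hx.trans hr.symm)
  obtain ⟨z, hzq, z', -, he, hz⟩ := exists_exit_of_not_reachable hsx q
  rcases Sym2.eq_iff.mp he with ⟨rfl, -⟩ | ⟨rfl, -⟩
  · exact hzq
  · exact absurd hz.symm (notMem_side hb hs)

lemma dist_of_mem_side_of_mem_side (hG : G.Connected) (hb : G.IsBridge s(a, b))
    (hs : s ∈ side G b a) (hx : x ∈ side G a b) : G.dist s x = G.dist s a + 1 + G.dist b x := by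
  have hbx := dist_eq_add_of_forall_mem_support hG (s := a) (a := b) (x := x) fun q => by
    simpa using mem_support_of_isBridge (isBridge_symm hb) hx (mem_side_self b a) q.reverse
  rw [dist_eq_one_iff_adj.mpr (adj_of_isBridge hG hb)] at hbx
  rw [dist_eq_add_of_forall_mem_support hG (mem_support_of_isBridge hb hs hx), hbx, add_assoc]

lemma dist_of_mem_side (hG : G.Connected) (hb : G.IsBridge s(a, b)) (hx : x ∈ side G a b) :
    G.dist x a = G.dist x b + 1 := by
  rw [dist_of_mem_side_of_mem_side hG (isBridge_symm hb) hx (mem_side_self b a), dist_self]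

lemma dist_isBridge_cases (hG : G.Connected) (hb : G.IsBridge s(a, b)) (x : V) :
    G.dist x b = G.dist x a + 1 ∨ G.dist x a = G.dist x b + 1 :=
  (mem_side_or_mem_side hG a b x).imp (dist_of_mem_side hG (isBridge_symm hb))
    (dist_of_mem_side hG hb)

lemma mem_side_of_dist_le (hG : G.Connected) (hb : G.IsBridge s(a, b))
    (hx : G.dist x b ≤ G.dist x a) : x ∈ side G a b := by
  refine (mem_side_or_mem_side hG a b x).resolve_left fun h => ?_
  have := dist_of_mem_side hG (isBridge_symm hb) h
  omega

lemma dist_eq_of_isBridge (hG : G.Connected) (hb : G.IsBridge s(a, b))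
    (hs : G.dist s a ≤ G.dist s b) (hx : G.dist x b ≤ G.dist x a) :
    G.dist s x = G.dist s a + 1 + G.dist b x :=
  dist_of_mem_side_of_mem_side hG hb (mem_side_of_dist_le hG (isBridge_symm hb) hs)
    (mem_side_of_dist_le hG hb hx)

lemma mem_side_of_mem_support {u : V} {p : G.Walk u u} (hp : p.IsCycle)
    (hb : G.IsBridge s(a, b)) (hx : x ∈ p.support) (hy : y ∈ p.support) (h : x ∈ side G a b) :
    y ∈ side G a b := by
  classical
  have hedges : ∀ e ∈ p.edges, e ∈ (G.deleteEdges {s(a, b)}).edgeSet := by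
    intro e he
    rw [edgeSet_deleteEdges]
    refine ⟨p.edges_subset_edgeSet he, fun h => hb.notMem_edges_of_isCycle hp ?_⟩
    rwa [← Set.mem_singleton_iff.mp h]
  rw [← p.support_transfer hedges] at hx hy
  exact h.trans (((p.transfer _ hedges).takeUntil x hx).reachable.symm.trans
    ((p.transfer _ hedges).takeUntil y hy).reachable)

lemma notMem_side_of_disjoint (hG : G.IsCactus) (hbi : G.IsBiactive S)
    (hb : G.IsBridge s(a, b)) (hfree : Disjoint (side G a b) S) {u : V} {p : G.Walk u u}
    (hp : p.IsCycle) (hx : x ∈ p.support) : x ∉ side G a b := by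
  classical
  intro hbx
  obtain ⟨s, hs, hne⟩ := exists_gateIdx_ne hG hbi hp (gateIdx p a)
  have hsa := (mem_side_or_mem_side hG.1 a b s).resolve_right fun h => hfree.notMem_of_mem_left h hs
  obtain ⟨q⟩ := mem_side_swap.mp hsa
  have hnr : ¬ (G.deleteEdges p.edgeSet).Reachable a s :=
    fun hr => hne (gateIdx_eq_of_reachable hG hp hr).symm
  -- A walk from `a` to `s` on the side of `a` would have to enter the cycle.
  obtain ⟨z, hz, z', -, he, -⟩ :=
    exists_exit_of_not_reachable hnr (q.mapLe (deleteEdges_le _))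
  have hzp := p.fst_mem_support_of_mem_edges he
  rw [Walk.support_mapLe_eq_support] at hz
  exact notMem_side hb (mem_side_swap.mpr (q.takeUntil z hz).reachable)
    (mem_side_of_mem_support hp hb hx hzp hbx)

lemma isBridge_of_side_disjoint (hG : G.IsCactus) (hbi : G.IsBiactive S)
    (hb : G.IsBridge s(a, b)) (hfree : Disjoint (side G a b) S) (hx : x ∈ side G a b)
    (hadj : G.Adj x y) : G.IsBridge s(x, y) := by
  by_contra hnb
  obtain ⟨p, hp, -⟩ := exists_isCycle_of_not_isBridge hadj hnb
  exact notMem_side_of_disjoint hG hbi hb hfree hp p.start_mem_support hx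

lemma side_ssubset_side (hG : G.Connected) (hb : G.IsBridge s(a, b)) (hbc : G.IsBridge s(b, c))
    (hca : c ≠ a) : side G b c ⊂ side G a b := by
  refine (Set.ssubset_iff_of_subset fun y hy => ?_).mpr
    ⟨b, mem_side_self a b, notMem_side hbc (mem_side_self c b)⟩
  have hc : c ∈ side G a b := mem_side_of_adj (mem_side_self a b) (adj_of_isBridge hG hbc) <| by
    simp [hca, (adj_of_isBridge hG hb).ne']
  refine (mem_side_or_mem_side hG a b y).resolve_left fun hay => ?_
  have h1 := dist_of_mem_side hG hbc hy
  have h2 := dist_of_mem_side_of_mem_side hG hb hay hc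
  have h3 := dist_of_mem_side hG (isBridge_symm hb) hay
  omega

lemma dist_left_of_mem_side (hG : G.Connected) (hb : G.IsBridge s(a, b)) (hy : y ∈ side G a b) :
    G.dist a y = G.dist b y + 1 := by
  rw [dist_comm, dist_of_mem_side hG hb hy, dist_comm]

lemma exists_adj_mem_side (hG : G.Connected) (hb : G.IsBridge s(a, b)) (hy : y ∈ side G a b)
    (hyb : y ≠ b) : ∃ c, G.Adj b c ∧ c ≠ a ∧ G.dist b y = G.dist c y + 1 := by
  obtain ⟨c, hbc, hd⟩ := exists_adj_dist_add_one hG hyb.symm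
  refine ⟨c, hbc, ?_, hd.symm⟩
  rintro rfl
  have := dist_left_of_mem_side hG hb hy
  omega

lemma mem_side_iff_of_adj (hG : G.Connected) (hb : G.IsBridge s(a, b)) (hbc : G.IsBridge s(b, c))
    (hca : c ≠ a) (h : ∀ z, G.Adj b z → z = a ∨ z = c) :
    y ∈ side G a b ↔ y ∈ side G b c ∨ y = b := by
  refine ⟨fun hy => or_iff_not_imp_right.mpr fun hyb => ?_, ?_⟩
  · obtain ⟨c', hbc', hca', hd⟩ := exists_adj_mem_side hG hb hy hyb
    obtain rfl := (h c' hbc').resolve_left hca'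
    refine mem_side_of_dist_le hG hbc ?_
    rw [dist_comm, dist_comm (v := b)]
    omega
  · rintro (hy | rfl)
    · exact (side_ssubset_side hG hb hbc hca).subset hy
    · exact mem_side_self a _

end Bridge

/-! ### Threads -/

section Thread

variable [G.LocallyFinite] {a b v x y z : V} {l : List V}

lemma three_le_degree (hx : G.Adj v x) (hy : G.Adj v y) (hz : G.Adj v z) (hxy : x ≠ y)
    (hxz : x ≠ z) (hyz : y ≠ z) : 3 ≤ G.degree v :=
  Finset.two_lt_card.mpr ⟨x, by simpa, y, by simpa, z, by simpa, hxy, hxz, hyz⟩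

lemma two_le_degree (hx : G.Adj v x) (hy : G.Adj v y) (hxy : x ≠ y) : 2 ≤ G.degree v :=
  Finset.one_lt_card.mpr ⟨x, by simpa, y, by simpa, hxy⟩

lemma degree_eq_two (hx : G.Adj v x) (hy : G.Adj v y) (hxy : x ≠ y)
    (h : ∀ z, G.Adj v z → z = x ∨ z = y) : G.degree v = 2 := by
  classical
  refine Finset.card_eq_two.mpr ⟨x, y, hxy, ?_⟩
  ext z
  simp only [mem_neighborFinset, Finset.mem_insert, Finset.mem_singleton]
  exact ⟨h z, by rintro (rfl | rfl) <;> assumption⟩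

/-- The side of `b` of the edge `ab` is a path, listed by `l` from its leaf to `b`. -/
structure IsPathSide (G : SimpleGraph V) [G.LocallyFinite] (a b : V) (l : List V) : Prop where
  isChain : l.IsChain G.Adj
  head : ∃ u ∈ l.head?, G.degree u = 1
  tail : ∀ u ∈ l.tail, G.degree u = 2
  last : b ∈ l.getLast?
  mem_iff : ∀ y, y ∈ l ↔ y ∈ side G a b
  dist_getElem : ∀ (i : ℕ) (hi : i < l.length), G.dist a l[i] + i = l.length

namespace IsPathSide

lemma nodup (h : IsPathSide G a b l) : l.Nodup := by
  refine List.nodup_iff_injective_get.mpr fun i j hij => Fin.ext ?_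
  have hi := h.dist_getElem i i.2
  have hj := h.dist_getElem j j.2
  simp only [List.get_eq_getElem] at hij
  rw [hij] at hi
  omega

lemma isFreeThread (h : IsPathSide G a b l) (hG : G.Connected) (hb : G.IsBridge s(a, b))
    (hdeg : 3 ≤ G.degree a) (hfree : Disjoint (side G a b) S) : G.IsFreeThread S a l :=
  ⟨⟨hdeg, h.isChain, h.nodup, h.head, h.tail, b, h.last, (adj_of_isBridge hG hb).symm⟩,
    fun _ hu => hfree.notMem_of_mem_left ((h.mem_iff _).mp hu)⟩

lemma degree_le (h : IsPathSide G a b l) (hy : y ∈ side G a b) : G.degree y ≤ 2 := by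
  obtain ⟨u, hu, hdeg⟩ := h.head
  rw [← h.mem_iff, ← List.cons_head?_tail hu, List.mem_cons] at hy
  rcases hy with rfl | hy
  · omega
  · exact (h.tail y hy).le

lemma dist_le (h : IsPathSide G a b l) (hy : y ∈ side G a b) : G.dist a y ≤ l.length := by
  obtain ⟨i, hi, rfl⟩ := List.getElem_of_mem ((h.mem_iff y).mpr hy)
  have := h.dist_getElem i hi
  omega

lemma dist_inj (h : IsPathSide G a b l) (hy : y ∈ side G a b) (hz : z ∈ side G a b)
    (hyz : G.dist a y = G.dist a z) : y = z := by
  obtain ⟨i, hi, rfl⟩ := List.getElem_of_mem ((h.mem_iff y).mpr hy)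
  obtain ⟨j, hj, rfl⟩ := List.getElem_of_mem ((h.mem_iff z).mpr hz)
  have h1 := h.dist_getElem i hi
  have h2 := h.dist_getElem j hj
  congr 1
  omega

end IsPathSide

lemma isPathSide_singleton (hG : G.Connected) (hb : G.IsBridge s(a, b))
    (h : ∀ c, G.Adj b c → c = a) : IsPathSide G a b [b] where
  isChain := by simp
  head := ⟨b, by simp,
    degree_eq_one_iff_existsUnique_adj.mpr ⟨a, (adj_of_isBridge hG hb).symm, h⟩⟩
  tail := by simp
  last := by simp
  mem_iff y := by
    rw [List.mem_singleton]
    refine ⟨fun h => h ▸ mem_side_self a _, fun hy => ?_⟩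
    by_contra hyb
    obtain ⟨c, hbc, hca, -⟩ := exists_adj_mem_side hG hb hy hyb
    exact hca (h c hbc)
  dist_getElem i hi := by
    obtain rfl : i = 0 := by simpa using hi
    simp [dist_eq_one_iff_adj.mpr (adj_of_isBridge hG hb)]

lemma IsPathSide.append (hG : G.Connected) (hb : G.IsBridge s(a, b)) (hbc : G.IsBridge s(b, c))
    (hca : c ≠ a) (h : ∀ z, G.Adj b z → z = a ∨ z = c) (hl : IsPathSide G b c l) :
    IsPathSide G a b (l ++ [b]) := by
  have hab := adj_of_isBridge hG hb
  have hadj := adj_of_isBridge hG hbc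
  obtain ⟨u, hu, hudeg⟩ := hl.head
  have hlne : l ≠ [] := by
    rintro rfl
    simp at hu
  refine ⟨?_, ?_, ?_, by simp, fun y => ?_, fun i hi => ?_⟩
  · refine List.isChain_append.mpr ⟨hl.isChain, by simp, fun x hx y hy => ?_⟩
    obtain rfl := Option.mem_unique hl.last hx
    obtain rfl : b = y := by simpa using hy
    exact hadj.symm
  · rw [List.head?_append_of_ne_nil _ hlne]
    exact ⟨u, hu, hudeg⟩
  · rw [List.tail_append_of_ne_nil hlne]
    intro x hx
    rcases List.mem_append.mp hx with hx | hx
    · exact hl.tail x hx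
    · obtain rfl := List.mem_singleton.mp hx
      exact degree_eq_two hab.symm hadj hca.symm h
  · rw [mem_side_iff_of_adj hG hb hbc hca h, List.mem_append, hl.mem_iff, List.mem_singleton]
  · rw [List.length_append, List.length_singleton]
    rcases lt_or_ge i l.length with hil | hil
    · have hmem : l[i] ∈ side G b c := (hl.mem_iff _).mp (List.getElem_mem hil)
      rw [List.getElem_append_left hil,
        dist_left_of_mem_side hG hb ((side_ssubset_side hG hb hbc hca).subset hmem),
        ← hl.dist_getElem i hil]
      omega
    · obtain rfl : i = l.length := by
        rw [List.length_append, List.length_singleton] at hi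
        omega
      rw [List.getElem_concat_length rfl, dist_eq_one_iff_adj.mpr hab, add_comm]

lemma exists_isPathSide [Finite V] (hG : G.IsCactus) (hbi : G.IsBiactive S)
    (hbr : G.IsBranchResolving S) (hb : G.IsBridge s(a, b)) (hfree : Disjoint (side G a b) S) :
    ∃ l, IsPathSide G a b l := by
  induction hn : (side G a b).ncard using Nat.strong_induction_on generalizing a b with
  | _ n ih =>
  have hbridge {c : V} (hbc : G.Adj b c) : G.IsBridge s(b, c) :=
    isBridge_of_side_disjoint hG hbi hb hfree (mem_side_self a b) hbc
  have hfree' {c : V} (hbc : G.Adj b c) (hca : c ≠ a) : Disjoint (side G b c) S :=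
    hfree.mono_left (side_ssubset_side hG.1 hb (hbridge hbc) hca).subset
  have hpath {c : V} (hbc : G.Adj b c) (hca : c ≠ a) : ∃ l, IsPathSide G b c l :=
    ih _ (hn ▸ Set.ncard_lt_ncard (side_ssubset_side hG.1 hb (hbridge hbc) hca) (Set.toFinite _))
      (hbridge hbc) (hfree' hbc hca) rfl
  by_cases h : ∃ c, G.Adj b c ∧ c ≠ a
  · obtain ⟨c, hbc, hca⟩ := h
    obtain ⟨l, hl⟩ := hpath hbc hca
    refine ⟨l ++ [b], hl.append hG.1 hb (hbridge hbc) hca ?_⟩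
    by_contra! hz
    obtain ⟨z, hbz, hza, hzc⟩ := hz
    obtain ⟨l', hl'⟩ := hpath hbz hza
    have hdeg : 3 ≤ G.degree b :=
      three_le_degree (adj_of_isBridge hG.1 hb).symm hbc hbz hca.symm hza.symm hzc.symm
    -- Two free threads would hang at `b`.
    obtain rfl := hbr b l l' (hl.isFreeThread hG.1 (hbridge hbc) hdeg (hfree' hbc hca))
      (hl'.isFreeThread hG.1 (hbridge hbz) hdeg (hfree' hbz hza))
    exact hzc (Option.mem_unique hl'.last hl.last)
  · push Not at h
    exact ⟨[b], isPathSide_singleton hG.1 hb h⟩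

/-- The vertex at distance `t` from `v` on the thread `l` hanging at `v`; in particular `v` itself
for `t = 0`. -/
def threadVertex (v : V) (l : List V) (t : ℕ) : V := l.getD (l.length - t) v

lemma threadVertex_zero (v : V) (l : List V) : threadVertex v l 0 = v := by
  simp [threadVertex]

lemma threadVertex_mem {t : ℕ} (h0 : 0 < t) (ht : t ≤ l.length) : threadVertex v l t ∈ l := by
  rw [threadVertex, List.getD_eq_getElem _ _ (by omega)]
  exact List.getElem_mem _

lemma length_pos_of_isThread (h : G.IsThread v l) : 0 < l.length := by
  obtain ⟨-, -, -, ⟨x, hx, -⟩, -⟩ := h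
  exact List.length_pos_of_mem (List.mem_of_mem_head? hx)

lemma adj_threadVertex (h : G.IsThread v l) {t : ℕ} (ht : t < l.length) :
    G.Adj (threadVertex v l t) (threadVertex v l (t + 1)) := by
  obtain ⟨-, hchain, -, -, -, z, hz, hzv⟩ := h
  rw [adj_comm, threadVertex, threadVertex, List.getD_eq_getElem _ _ (by omega)]
  rcases Nat.eq_zero_or_pos t with rfl | h0
  · rw [List.getLast?_eq_getElem?, List.getElem?_eq_getElem (by omega), Option.mem_some_iff] at hz
    simpa [hz] using hzv
  · rw [List.getD_eq_getElem _ _ (by omega)]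
    have := List.isChain_iff_getElem.mp hchain (l.length - (t + 1)) (by omega)
    simpa only [show l.length - (t + 1) + 1 = l.length - t by omega] using this

lemma degree_threadVertex_length (h : G.IsThread v l) :
    G.degree (threadVertex v l l.length) = 1 := by
  obtain ⟨-, -, -, ⟨x, hx, hdeg⟩, -⟩ := h
  rw [List.head?_eq_getElem?, Option.mem_def] at hx
  rwa [threadVertex, Nat.sub_self, List.getD_eq_getElem?_getD, hx]

lemma degree_threadVertex (h : G.IsThread v l) {t : ℕ} (h0 : 0 < t) (ht : t < l.length) :
    G.degree (threadVertex v l t) = 2 := by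
  refine h.2.2.2.2.1 _ ?_
  rw [threadVertex, List.getD_eq_getElem _ _ (by omega)]
  refine List.mem_iff_getElem.mpr ⟨l.length - t - 1, by rw [List.length_tail]; omega, ?_⟩
  simp only [List.getElem_tail, show l.length - t - 1 + 1 = l.length - t by omega]

lemma threadVertex_ne (h : G.IsThread v l) {t t' : ℕ} (htt : t < t') (ht : t' ≤ l.length) :
    threadVertex v l t ≠ threadVertex v l t' := by
  rcases Nat.eq_zero_or_pos t with rfl | h0
  · rw [threadVertex_zero]
    intro he
    have h3 : 3 ≤ G.degree v := h.1
    rw [he] at h3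
    rcases ht.lt_or_eq with ht | rfl
    · rw [degree_threadVertex h htt ht] at h3
      omega
    · rw [degree_threadVertex_length h] at h3
      omega
  · rw [threadVertex, threadVertex, List.getD_eq_getElem _ _ (by omega),
      List.getD_eq_getElem _ _ (by omega), Ne, h.2.2.1.getElem_inj_iff]
    omega

lemma eq_threadVertex_of_adj (h : G.IsThread v l) {t : ℕ} (ht : t < l.length)
    (hy : G.Adj (threadVertex v l (t + 1)) y) :
    y = threadVertex v l t ∨ t + 2 ≤ l.length ∧ y = threadVertex v l (t + 2) := by
  have hadj := (adj_threadVertex h ht).symm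
  by_contra! hne
  rcases Nat.lt_or_eq_of_le ht with ht' | ht'
  · have := three_le_degree hadj (adj_threadVertex h ht') hy (threadVertex_ne h (by omega) ht')
      hne.1.symm (hne.2 ht').symm
    rw [degree_threadVertex h (by omega) ht'] at this
    omega
  · have := two_le_degree hadj hy hne.1.symm
    rw [Nat.succ_eq_add_one] at ht'
    rw [ht', degree_threadVertex_length h] at this
    omega

lemma dist_threadVertex_succ (hG : G.Connected) (h : G.IsFreeThread S v l) {s : V} (hs : s ∈ S)
    {t : ℕ} (ht : t < l.length) :
    G.dist s (threadVertex v l (t + 1)) = G.dist s (threadVertex v l t) + 1 := by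
  induction hr : l.length - t generalizing t with
  | zero => omega
  | succ r ih =>
    have hne : threadVertex v l (t + 1) ≠ s := fun he =>
      h.2 _ (threadVertex_mem (Nat.succ_pos t) ht) (he ▸ hs)
    obtain ⟨y, hy, hd⟩ := exists_adj_dist_add_one hG hne
    rw [dist_comm, dist_comm (v := s)] at hd
    rcases eq_threadVertex_of_adj h.1 ht hy with rfl | ⟨ht', rfl⟩
    · exact hd.symm
    · have : G.dist s (threadVertex v l (t + 2)) = _ := ih ht' (by omega)
      omega

lemma dist_threadVertex (hG : G.Connected) (h : G.IsFreeThread S v l) {s : V} (hs : s ∈ S)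
    {t : ℕ} (ht : t ≤ l.length) : G.dist s (threadVertex v l t) = G.dist s v + t := by
  induction t with
  | zero => rw [threadVertex_zero, add_zero]
  | succ t ih => rw [dist_threadVertex_succ hG h hs ht, ih (by omega), add_assoc]

lemma threadVertex_notMem_support (h : G.IsThread v l) {u : V} {p : G.Walk u u} (hp : p.IsCycle)
    {t : ℕ} (ht : t < l.length) : threadVertex v l (t + 1) ∉ p.support := by
  induction hr : l.length - t generalizing t with
  | zero => omega
  | succ r ih =>
    intro hx
    have hprev (y : V) (hy : s(threadVertex v l (t + 1), y) ∈ p.edgeSet) :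
        y = threadVertex v l t := by
      refine (eq_threadVertex_of_adj h ht (p.edges_subset_edgeSet hy)).resolve_right ?_
      rintro ⟨ht', rfl⟩
      exact ih ht' (by omega) (p.snd_mem_support_of_mem_edges hy)
    obtain ⟨y, z, hyz, hN⟩ := Set.ncard_eq_two.mp (hp.ncard_neighborSet_toSubgraph_eq_two hx)
    have hmem (w : V) (hw : w ∈ ({y, z} : Set V)) :
        s(threadVertex v l (t + 1), w) ∈ p.edgeSet := by
      rwa [← hN, Subgraph.mem_neighborSet, Walk.adj_toSubgraph_iff_mem_edges] at hw
    exact hyz ((hprev y (hmem y (by simp))).trans (hprev z (hmem z (by simp))).symm)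

end Thread

/-! ### Free edges -/

/-- The edge `wb` is free at `w`: it leads away from every vertex of `S`, strictly if `κ = 1`. The
parameter `κ` is `1` in the vertex version of the theorem and `0` in the edge version. -/
def IsFreeEdge (G : SimpleGraph V) (S : Set V) (κ : ℕ) (w b : V) : Prop :=
  G.Adj w b ∧ ∀ s ∈ S, G.dist s w + κ ≤ G.dist s b

/-- Two distinct edges are free at the same vertex. This is the local obstruction to `S` being a
vertex (`κ = 1`) or an edge (`κ = 0`) metric generator. -/
def HasFreePair (G : SimpleGraph V) (S : Set V) (κ : ℕ) : Prop :=
  ∃ w b c, b ≠ c ∧ IsFreeEdge G S κ w b ∧ IsFreeEdge G S κ w c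

/-- The common form of `ConfigB` (`κ = 1`) and `ConfigD` (`κ = 0`), with the roundings of `g / 2`
cleared. -/
def ConfigThread (G : SimpleGraph V) [G.LocallyFinite] (S : Set V) (κ : ℕ) {u : V}
    (p : G.Walk u u) : Prop :=
  2 * G.lastActive S p + 1 + κ ≤ p.length ∧
    ∃ i : ℕ, ((G.lastActive S p ≤ i ∧ 2 * i + 1 + κ ≤ p.length) ∨
        (p.length + 2 * G.lastActive S p + 1 + κ ≤ 2 * i ∧ i + 1 ≤ p.length) ∨ i = 0) ∧
      ∃ l, G.IsFreeThread S (p.getVert i) l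

/-- The common form of `IsVertexCritical` (`κ = 1`) and `IsEdgeCritical` (`κ = 0`). -/
def IsCritical (G : SimpleGraph V) (S : Set V) (κ : ℕ) {u : V} (p : G.Walk u u) (v : V) : Prop :=
  ∃ (a b : V) (P : G.Walk a b), G.IsSPath S p P ∧ (v = a ∨ v = b) ∧
    2 * P.length + 1 + κ ≤ p.length

/-- The common form of `VertexCriticallyIncident` (`κ = 1`) and `EdgeCriticallyIncident`
(`κ = 0`). -/
def CriticallyIncident (G : SimpleGraph V) (S : Set V) (κ : ℕ) {u w : V} (p : G.Walk u u)
    (q : G.Walk w w) : Prop :=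
  p.edgeSet ≠ q.edgeSet ∧ ∃ v, v ∈ p.support ∧ v ∈ q.support ∧
    IsCritical G S κ p v ∧ IsCritical G S κ q v

section Unification

variable {u v w : V}

lemma configB_iff [G.LocallyFinite] (p : G.Walk u u) : G.ConfigB S p ↔ ConfigThread G S 1 p :=
  and_congr (by omega) (exists_congr fun i => and_congr (by omega) Iff.rfl)

lemma configD_iff [G.LocallyFinite] (p : G.Walk u u) : G.ConfigD S p ↔ ConfigThread G S 0 p :=
  and_congr (by omega) (exists_congr fun i => and_congr (by omega) Iff.rfl)

lemma isVertexCritical_iff (p : G.Walk u u) (v : V) :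
    G.IsVertexCritical S p v ↔ IsCritical G S 1 p v :=
  exists₃_congr fun _ _ _ => and_congr_right' (and_congr_right' (by omega))

lemma isEdgeCritical_iff (p : G.Walk u u) (v : V) :
    G.IsEdgeCritical S p v ↔ IsCritical G S 0 p v :=
  exists₃_congr fun _ _ _ => and_congr_right' (and_congr_right' (by omega))

lemma vertexCriticallyIncident_iff (p : G.Walk u u) (q : G.Walk w w) :
    G.VertexCriticallyIncident S p q ↔ CriticallyIncident G S 1 p q := by
  simp only [VertexCriticallyIncident, CriticallyIncident, isVertexCritical_iff]

lemma edgeCriticallyIncident_iff (p : G.Walk u u) (q : G.Walk w w) :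
    G.EdgeCriticallyIncident S p q ↔ CriticallyIncident G S 0 p q := by
  simp only [EdgeCriticallyIncident, CriticallyIncident, isEdgeCritical_iff]

end Unification

section FreeEdgeOnCycle

variable {w : V} {p : G.Walk w w}

lemma dist_start (hG : G.IsCactus) (hp : p.IsCycle) (s : V) :
    G.dist s w = G.dist s (p.getVert (gateIdx p s)) + cycDist p.length (gateIdx p s) 0 := by
  rw [← dist_getVert hG hp s (Nat.zero_le _), p.getVert_zero]

lemma exists_gateIdx_eq_lastActive (hG : G.IsCactus) (hbi : G.IsBiactive S) (hp : p.IsCycle) :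
    ∃ s ∈ S, gateIdx p s = G.lastActive S p := by
  obtain ⟨s, hs, -⟩ := exists_gateIdx_ne hG hbi hp 0
  obtain ⟨hk, hmem⟩ := lastActive_mem hp ⟨_, getVert_gateIdx_mem_activeSet hG.1 hp hs⟩
  exact (getVert_mem_activeSet_iff hG hp hk).mp hmem

lemma isFreeEdge_penultimate_iff (hG : G.IsCactus) (hbi : G.IsBiactive S) (hκ : κ ≤ 1)
    (hp : p.IsCycle) :
    IsFreeEdge G S κ w p.penultimate ↔ 2 * G.lastActive S p + 1 + κ ≤ p.length := by
  have hlen := hp.three_le_length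
  have hdist (s : V) : G.dist s w + κ ≤ G.dist s p.penultimate ↔
      2 * gateIdx p s + 1 + κ ≤ p.length := by
    have := gateIdx_lt hG.1 hp s
    rw [dist_start hG hp, dist_getVert hG hp s (Nat.sub_le p.length 1)]
    simp only [cycDist]
    omega
  simp only [IsFreeEdge, (p.adj_penultimate hp.not_nil).symm, true_and, hdist]
  refine ⟨fun h => ?_, fun h s hs => ?_⟩
  · obtain ⟨s, hs, hk⟩ := exists_gateIdx_eq_lastActive hG hbi hp
    exact hk ▸ h s hs
  · have := gateIdx_le_lastActive hG.1 hp hs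
    omega

lemma not_isFreeEdge_snd (hG : G.IsCactus) (hbi : G.IsBiactive S) (hp : p.IsCycle)
    (h : 2 * G.lastActive S p + 1 ≤ p.length) : ¬ IsFreeEdge G S κ w p.snd := by
  intro hfree
  have hlen := hp.three_le_length
  obtain ⟨s, hs, hs0⟩ := exists_gateIdx_ne hG hbi hp 0
  have hle := gateIdx_le_lastActive hG.1 hp hs
  have hd := hfree.2 s hs
  rw [dist_start hG hp, dist_getVert hG hp s (by omega : 1 ≤ p.length)] at hd
  simp only [cycDist] at hd
  omega

lemma edgeSet_ne_of_isFreeEdge (hG : G.IsCactus) (hbi : G.IsBiactive S) (hκ : κ ≤ 1)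
    {q : G.Walk w w} (hp : p.IsCycle) (hq : q.IsCycle) (hpfree : IsFreeEdge G S κ w p.penultimate)
    (hqfree : IsFreeEdge G S κ w q.penultimate) (hne : p.penultimate ≠ q.penultimate) :
    p.edgeSet ≠ q.edgeSet := by
  intro heq
  have hmem : s(w, q.penultimate) ∈ p.edgeSet := by
    rw [heq, Sym2.eq_swap]
    exact q.mk_penultimate_end_mem_edges hq.not_nil
  have hmem' : q.penultimate ∈ p.toSubgraph.neighborSet w := p.adj_toSubgraph_iff_mem_edges.mpr hmem
  rw [hp.neighborSet_toSubgraph_endpoint] at hmem'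
  refine not_isFreeEdge_snd (κ := κ) hG hbi hp ?_ (hmem'.resolve_right hne.symm ▸ hqfree)
  have := (isFreeEdge_penultimate_iff hG hbi hκ hp).mp hpfree
  omega

end FreeEdgeOnCycle

/-! ### Free pairs produce configurations -/

section Configurations

variable {w : V} {p : G.Walk w w}

lemma isActivePath_take (hp : p.IsCycle) {k : ℕ} (hk : k < p.length) (h : G.lastActive S p ≤ k) :
    G.IsActivePath S p (p.take k) := by
  refine ⟨hp.isPath_take hk, fun e he => (p.isSubwalk_take k).edges_subset he,
    fun v hv => (p.isSubwalk_take k).support_subset hv, fun v hv => ?_⟩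
  obtain ⟨i, hi, rfl⟩ := exists_getVert_eq hp hv.1
  have hmem := (p.take k).getVert_mem_support i
  rwa [p.take_getVert, min_eq_right ((le_lastActive hi hv).trans h)] at hmem

lemma isCritical_start (hG : G.IsCactus) (hp : p.IsCycle) (hw : w ∈ G.activeSet S p)
    (h : 2 * G.lastActive S p + 1 + κ ≤ p.length) : IsCritical G S κ p w := by
  obtain ⟨hk, hmem⟩ := lastActive_mem hp ⟨w, hw⟩
  have hlen : (p.take (G.lastActive S p)).length = G.lastActive S p := by
    rw [p.take_length, min_eq_left hk.le]
  have hdist := dist_getVert_getVert hG hp (i := 0) (by omega) hk.le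
  rw [p.getVert_zero] at hdist
  refine ⟨w, _, _, ⟨isActivePath_take hp hk le_rfl, fun c d Q hQ => ?_⟩, Or.inl rfl, by rwa [hlen]⟩
  have hle := dist_le_length_of_mem_support (hQ.2.2.2 w hw) (hQ.2.2.2 _ hmem)
  rw [hlen]
  simp only [cycDist] at hdist
  omega

lemma exists_isCycle_getVert_sub (hp : p.IsCycle) {k : ℕ} (hk : k < p.length) :
    ∃ q : G.Walk (p.getVert k) (p.getVert k), q.IsCycle ∧ q.edgeSet = p.edgeSet ∧
      q.length = p.length ∧ (∀ i ≤ k, q.getVert i = p.getVert (k - i)) ∧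
      ∀ i, k < i → i ≤ p.length → q.getVert i = p.getVert (k + p.length - i) := by
  obtain ⟨r, hr, hedge, hlen, hlow, hhigh⟩ := exists_isCycle_getVert hp hk
  refine ⟨r.reverse, hr.reverse, by rw [Walk.edgeSet_reverse, hedge],
    by rw [r.length_reverse, hlen], fun i hi => ?_, fun i hi hi' => ?_⟩
  · rw [r.getVert_reverse, hlen, hhigh _ (by omega) (by omega)]
    congr 1
    omega
  · rw [r.getVert_reverse, hlen, hlow _ (by omega)]
    congr 1
    omega

lemma exists_configThread_of_isFreeThread [G.LocallyFinite] (hG : G.IsCactus)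
    (hbi : G.IsBiactive S) (hp : p.IsCycle) (h : 2 * G.lastActive S p + 1 + κ ≤ p.length)
    {l : List V} (hl : G.IsFreeThread S w l) :
    ∃ (u : V) (q : G.Walk u u), G.IsCanonicalCycle S q ∧ ConfigThread G S κ q := by
  obtain ⟨s, hs, -⟩ := exists_gateIdx_ne hG hbi hp 0
  obtain ⟨hk, hmem⟩ := lastActive_mem hp ⟨_, getVert_gateIdx_mem_activeSet hG.1 hp hs⟩
  set k := G.lastActive S p
  -- The labelling `v_k, v_{k-1}, …, v_0, v_{g-1}, …, v_{k+1}` is canonical, with `w = v_0` at `k`.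
  obtain ⟨q, hq, hedge, hlen, hlow, hhigh⟩ := exists_isCycle_getVert_sub hp hk
  have hact := activeSet_eq_of_edgeSet_eq (S := S) hp hq hedge
  have hlast : G.lastActive S q ≤ k := by
    refine lastActive_le hq ⟨_, hact ▸ hmem⟩ fun i hi hi' => ?_
    by_contra! hik
    rw [hact, hhigh i hik (by omega)] at hi'
    have := le_lastActive (by omega) hi'
    omega
  refine ⟨_, q, isCanonicalCycle_of_two_mul_lastActive_le hG hq (hact ▸ hmem) (by omega),
    by omega, k, Or.inl ⟨hlast, by omega⟩, l, ?_⟩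
  rwa [hlow k le_rfl, Nat.sub_self, p.getVert_zero]

lemma gateIdx_start (hG : G.IsCactus) (hp : p.IsCycle) : gateIdx p w = 0 := by
  have hlen := hp.three_le_length
  simpa using gateIdx_getVert hG hp (i := 0) (by omega)

lemma reachable_deleteEdges_of_mem_support {q : G.Walk w w} (hG : G.IsCactus) (hp : p.IsCycle)
    (hq : q.IsCycle) (hpq : p.edgeSet ≠ q.edgeSet) {x : V} (hx : x ∈ p.support) :
    (G.deleteEdges q.edgeSet).Reachable w x := by
  classical
  have hdisj : ∀ e ∈ p.edges, e ∉ q.edgeSet := fun e he he' =>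
    hpq (edgeSet_eq_of_mem hG hp hq he he')
  rw [← p.support_transfer (H := G.deleteEdges q.edgeSet) fun e he => by
    simpa using ⟨p.edges_subset_edgeSet he, hdisj e he⟩] at hx
  exact (Walk.takeUntil _ x hx).reachable

lemma gateIdx_eq_zero_of_ne_zero {q : G.Walk w w} (hG : G.IsCactus) (hp : p.IsCycle)
    (hq : q.IsCycle) (hpq : p.edgeSet ≠ q.edgeSet) {z : V} (hz : gateIdx p z ≠ 0) :
    gateIdx q z = 0 := by
  classical
  by_contra hz'
  have hnr : ¬ (G.deleteEdges q.edgeSet).Reachable z (p.getVert (gateIdx p z)) := by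
    refine fun hr => hz' ?_
    rw [← gateIdx_start hG hq, gateIdx_eq_of_reachable hG hq (hr.trans
      (reachable_deleteEdges_of_mem_support hG hp hq hpq (p.getVert_mem_support _)).symm)]
  -- A walk from `z` to its gate in `p` that avoids `p` has to meet `q`.
  obtain ⟨W⟩ := (reachable_gateIdx hG.1 hp z).symm
  obtain ⟨y, hy, y', -, he, -⟩ := exists_exit_of_not_reachable hnr (W.mapLe (deleteEdges_le _))
  rw [Walk.support_mapLe_eq_support] at hy
  have hwy := reachable_deleteEdges_of_mem_support hG hq hp hpq.symm
    (q.fst_mem_support_of_mem_edges he)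
  exact hz ((gateIdx_eq_of_reachable hG hp ((W.takeUntil y hy).reachable.trans hwy.symm)).trans
    (gateIdx_start hG hp))

lemma start_mem_activeSet {q : G.Walk w w} (hG : G.IsCactus) (hbi : G.IsBiactive S)
    (hp : p.IsCycle) (hq : q.IsCycle) (hpq : p.edgeSet ≠ q.edgeSet) : w ∈ G.activeSet S p := by
  obtain ⟨s, hs, hs0⟩ := exists_gateIdx_ne hG hbi hq 0
  simpa [gateIdx_eq_zero_of_ne_zero hG hq hp hpq.symm hs0] using
    getVert_gateIdx_mem_activeSet hG.1 hp hs

lemma disjoint_side_of_isFreeEdge (hG : G.Connected) {b : V} (h : IsFreeEdge G S κ w b)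
    (hb : G.IsBridge s(w, b)) : Disjoint (side G w b) S := by
  refine Set.disjoint_left.mpr fun y hy hyS => ?_
  have h1 := dist_of_mem_side hG hb hy
  have h2 := h.2 y hyS
  omega

lemma eq_start_or_mem_side [G.LocallyFinite] (hG : G.Connected) {b b' : V} (hbb' : b ≠ b')
    (hb : G.IsBridge s(w, b)) (hb' : G.IsBridge s(w, b')) (hdeg : G.degree w < 3) (y : V) :
    y = w ∨ y ∈ side G w b ∨ y ∈ side G w b' := by
  refine or_iff_not_imp_left.mpr fun hy => ?_
  obtain ⟨c, hc, hd⟩ := exists_adj_dist_add_one hG (Ne.symm hy)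
  rw [dist_comm, dist_comm (u := w)] at hd
  have hcb : c = b ∨ c = b' := by
    by_contra! hne
    exact hdeg.not_ge (three_le_degree (adj_of_isBridge hG hb) (adj_of_isBridge hG hb') hc hbb'
      hne.1.symm hne.2.symm)
  rcases hcb with rfl | rfl
  · exact Or.inl (mem_side_of_dist_le hG hb (by omega))
  · exact Or.inr (mem_side_of_dist_le hG hb' (by omega))

lemma not_isBridge_of_isFreeEdge [Finite V] [G.LocallyFinite] (hG : G.IsCactus)
    (hpath : ¬ (G.IsAcyclic ∧ ∀ v, G.degree v ≤ 2)) (hbi : G.IsBiactive S)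
    (hbr : G.IsBranchResolving S) {b b' : V} (hbb' : b ≠ b') (h : IsFreeEdge G S κ w b)
    (h' : IsFreeEdge G S κ w b') (hb : G.IsBridge s(w, b)) : ¬ G.IsBridge s(w, b') := by
  intro hb'
  have hfree := disjoint_side_of_isFreeEdge hG.1 h hb
  have hfree' := disjoint_side_of_isFreeEdge hG.1 h' hb'
  obtain ⟨l, hl⟩ := exists_isPathSide hG hbi hbr hb hfree
  obtain ⟨l', hl'⟩ := exists_isPathSide hG hbi hbr hb' hfree'
  rcases le_or_gt 3 (G.degree w) with hdeg | hdeg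
  · obtain rfl := hbr w l l' (hl.isFreeThread hG.1 hb hdeg hfree)
      (hl'.isFreeThread hG.1 hb' hdeg hfree')
    exact hbb' (Option.mem_unique hl.last hl'.last)
  · have hcases := eq_start_or_mem_side hG.1 hbb' hb hb' hdeg
    refine hpath ⟨fun u p hp => ?_, fun v => ?_⟩
    · obtain ⟨x, hx, hxw⟩ : ∃ x ∈ p.support, x ≠ w := by
        by_contra! hne
        exact (p.adj_snd hp.not_nil).ne
          ((hne _ p.start_mem_support).trans (hne _ (p.getVert_mem_support 1)).symm)
      rcases (hcases x).resolve_left hxw with hside | hside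
      · exact notMem_side_of_disjoint hG hbi hb hfree hp hx hside
      · exact notMem_side_of_disjoint hG hbi hb' hfree' hp hx hside
    · rcases hcases v with rfl | hside | hside
      · omega
      · exact hl.degree_le hside
      · exact hl'.degree_le hside

lemma exists_configThread_of_isBridge [Finite V] [G.LocallyFinite] (hG : G.IsCactus)
    (hbi : G.IsBiactive S) (hbr : G.IsBranchResolving S) (hκ : κ ≤ 1) {b b' : V}
    (h : IsFreeEdge G S κ w b) (h' : IsFreeEdge G S κ w b') (hb : G.IsBridge s(w, b))
    (hb' : ¬ G.IsBridge s(w, b')) :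
    ∃ (u : V) (q : G.Walk u u), G.IsCanonicalCycle S q ∧ ConfigThread G S κ q := by
  obtain ⟨p, hp, rfl⟩ := exists_isCycle_penultimate_eq h'.1 hb'
  have hfree := disjoint_side_of_isFreeEdge hG.1 h hb
  obtain ⟨l, hl⟩ := exists_isPathSide hG hbi hbr hb hfree
  have hne {y : V} (hy : s(w, y) ∈ p.edges) : b ≠ y := by
    rintro rfl
    exact hb.notMem_edges_of_isCycle hp hy
  have hsnd := p.mk_start_snd_mem_edges hp.not_nil
  have hpen := p.mk_penultimate_end_mem_edges hp.not_nil
  rw [Sym2.eq_swap] at hpen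
  have hdeg : 3 ≤ G.degree w :=
    three_le_degree h.1 (p.adj_snd hp.not_nil) h'.1 (hne hsnd) (hne hpen) hp.snd_ne_penultimate
  exact exists_configThread_of_isFreeThread hG hbi hp
    ((isFreeEdge_penultimate_iff hG hbi hκ hp).mp h') (hl.isFreeThread hG.1 hb hdeg hfree)

lemma exists_configThread_or_criticallyIncident [Finite V] [G.LocallyFinite]
    (hG : G.IsCactus) (hpath : ¬ (G.IsAcyclic ∧ ∀ v, G.degree v ≤ 2)) (hbi : G.IsBiactive S)
    (hbr : G.IsBranchResolving S) (hκ : κ ≤ 1) (h : HasFreePair G S κ) :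
    (∃ (u : V) (q : G.Walk u u), G.IsCanonicalCycle S q ∧ ConfigThread G S κ q) ∨
      ∃ (u v : V) (p : G.Walk u u) (q : G.Walk v v), p.IsCycle ∧ q.IsCycle ∧
        CriticallyIncident G S κ p q := by
  obtain ⟨w, b, b', hne, h, h'⟩ := h
  by_cases hb : G.IsBridge s(w, b)
  · exact Or.inl (exists_configThread_of_isBridge hG hbi hbr hκ h h' hb
      (not_isBridge_of_isFreeEdge hG hpath hbi hbr hne h h' hb))
  by_cases hb' : G.IsBridge s(w, b')
  · exact Or.inl (exists_configThread_of_isBridge hG hbi hbr hκ h' h hb' hb)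
  obtain ⟨p, hp, rfl⟩ := exists_isCycle_penultimate_eq h.1 hb
  obtain ⟨q, hq, rfl⟩ := exists_isCycle_penultimate_eq h'.1 hb'
  have hpq := edgeSet_ne_of_isFreeEdge hG hbi hκ hp hq h h' hne
  exact Or.inr ⟨w, w, p, q, hp, hq, hpq, w, p.start_mem_support, q.start_mem_support,
    isCritical_start hG hp (start_mem_activeSet hG hbi hp hq hpq)
      ((isFreeEdge_penultimate_iff hG hbi hκ hp).mp h),
    isCritical_start hG hq (start_mem_activeSet hG hbi hq hp hpq.symm)
      ((isFreeEdge_penultimate_iff hG hbi hκ hq).mp h')⟩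

end Configurations

/-! ### Configurations produce free pairs -/

section Converse

variable {u v b : V} {p : G.Walk u u}

lemma isFreeEdge_threadVertex [G.LocallyFinite] (hG : G.Connected) (hκ : κ ≤ 1) {l : List V}
    (hl : G.IsFreeThread S v l) : IsFreeEdge G S κ v (threadVertex v l 1) := by
  have hlen := length_pos_of_isThread hl.1
  refine ⟨?_, fun s hs => ?_⟩
  · simpa only [threadVertex_zero] using adj_threadVertex hl.1 hlen
  · rw [dist_threadVertex hG hl hs hlen]
    omega

lemma isFreeEdge_getVert (hG : G.IsCactus) (hp : p.IsCycle) {i j : ℕ} (hi : i ≤ p.length)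
    (hj : j ≤ p.length) (hadj : G.Adj (p.getVert i) (p.getVert j))
    (h : ∀ t ≤ G.lastActive S p, cycDist p.length t i + κ ≤ cycDist p.length t j) :
    IsFreeEdge G S κ (p.getVert i) (p.getVert j) := by
  refine ⟨hadj, fun s hs => ?_⟩
  rw [dist_getVert hG hp s hi, dist_getVert hG hp s hj]
  have := h _ (gateIdx_le_lastActive hG.1 hp hs)
  omega

lemma exists_isFreeEdge_getVert (hG : G.IsCactus) (hκ : κ ≤ 1) (hp : p.IsCycle) {i : ℕ}
    (hk : 2 * G.lastActive S p + 1 + κ ≤ p.length)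
    (hi : (G.lastActive S p ≤ i ∧ 2 * i + 1 + κ ≤ p.length) ∨
      (p.length + 2 * G.lastActive S p + 1 + κ ≤ 2 * i ∧ i + 1 ≤ p.length) ∨ i = 0) :
    ∃ j, IsFreeEdge G S κ (p.getVert i) (p.getVert j) := by
  have hpred {j : ℕ} (hj : j + 1 ≤ p.length)
      (h : p.length + 2 * G.lastActive S p + 1 + κ ≤ 2 * (j + 1)) :
      IsFreeEdge G S κ (p.getVert (j + 1)) (p.getVert j) :=
    isFreeEdge_getVert hG hp hj (by omega) (p.adj_getVert_succ hj).symm fun t ht => by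
      simp only [cycDist]
      omega
  rcases hi with hi | hi | rfl
  · refine ⟨i + 1, isFreeEdge_getVert hG hp (by omega) (by omega) (p.adj_getVert_succ (by omega))
      fun t ht => ?_⟩
    simp only [cycDist]
    omega
  · obtain ⟨j, rfl⟩ := Nat.exists_eq_succ_of_ne_zero (by omega : i ≠ 0)
    exact ⟨j, hpred (by omega) hi.1⟩
  · obtain ⟨j, hj⟩ := Nat.exists_eq_succ_of_ne_zero (by omega : p.length ≠ 0)
    have hclosed : p.getVert (j + 1) = p.getVert 0 := by
      rw [p.getVert_zero, p.getVert_of_length_le hj.le]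
    exact ⟨j, hclosed ▸ hpred hj.ge (by omega)⟩

lemma hasFreePair_of_configThread [G.LocallyFinite] (hG : G.IsCactus) (hκ : κ ≤ 1)
    (hp : p.IsCycle) (h : ConfigThread G S κ p) : HasFreePair G S κ := by
  obtain ⟨hk, i, hi, l, hl⟩ := h
  obtain ⟨j, hj⟩ := exists_isFreeEdge_getVert hG hκ hp hk hi
  refine ⟨_, _, _, fun heq => ?_, hj, isFreeEdge_threadVertex hG.1 hκ hl⟩
  exact threadVertex_notMem_support hl.1 hp (length_pos_of_isThread hl.1)
    (heq ▸ p.getVert_mem_support j)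

lemma length_eq_of_edgeSet_eq {q : G.Walk v v} (hp : p.IsCycle) (hq : q.IsCycle)
    (h : p.edgeSet = q.edgeSet) : p.length = q.length := by
  classical
  rw [← Walk.length_edges, ← Walk.length_edges,
    ← List.toFinset_card_of_nodup hp.isTrail.edges_nodup,
    ← List.toFinset_card_of_nodup hq.isTrail.edges_nodup]
  congr 1
  ext e
  simpa using Set.ext_iff.mp h e

lemma getVert_eq_of_edgeSet_subset {q : G.Walk v v} (hq : q.IsCycle) {P : G.Walk v b}
    (hP : P.IsPath) (hsub : P.edgeSet ⊆ q.edgeSet) (hlen : P.length < q.length)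
    (h1 : P.getVert 1 = q.getVert 1) {i : ℕ} (hi : i ≤ P.length) :
    P.getVert i = q.getVert i := by
  induction i using Nat.strong_induction_on with
  | _ i ih =>
    match i with
    | 0 => simp
    | 1 => exact h1
    | i + 2 =>
      have hedge : s(q.getVert (i + 1), P.getVert (i + 2)) ∈ q.edgeSet :=
        ih (i + 1) (by omega) (by omega) ▸ hsub (edge_getVert_mem P hi)
      refine (eq_getVert_or_eq_getVert_of_edge_mem hq (by omega) hedge).resolve_left fun h => ?_
      rw [← ih i (by omega) (by omega)] at h
      have := hP.getVert_injOn (Set.mem_ofPred_eq ▸ hi) (by simp; omega) h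
      omega

lemma length_pos_of_isActivePath (hbi : G.IsBiactive S) (hp : p.IsCycle) {P : G.Walk v b}
    (hP : G.IsActivePath S p P) : 0 < P.length := by
  by_contra! h0
  have hsub : G.activeSet S p ⊆ {v} := fun x hx => by
    obtain ⟨i, rfl, hi⟩ := Walk.mem_support_iff_exists_getVert.mp (hP.2.2.2 x hx)
    simp [Nat.le_zero.mp (hi.trans h0)]
  have := (hbi u p hp).trans ((Set.encard_le_encard hsub).trans_eq (Set.encard_singleton _))
  exact absurd this (by norm_num)

lemma exists_isCycle_lastActive_le (hG : G.IsCactus) (hbi : G.IsBiactive S) (hp : p.IsCycle)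
    {P : G.Walk v b} (hP : G.IsActivePath S p P) (hlen : P.length < p.length) :
    ∃ q : G.Walk v v, q.IsCycle ∧ q.edgeSet = p.edgeSet ∧ G.lastActive S q ≤ P.length := by
  obtain ⟨hpath, hsub, -, hact⟩ := id hP
  have hpos := length_pos_of_isActivePath hbi hp hP
  have hadj := P.adj_getVert_succ hpos
  have he := hsub (edge_getVert_mem P hpos)
  rw [P.getVert_zero, zero_add] at hadj he
  obtain ⟨q, hq, hq1⟩ := exists_isCycle_of_not_isBridge hadj
    fun h => h.notMem_edges_of_isCycle hp he
  have heq := edge_getVert_mem q (i := 0) (by have := hq.three_le_length; omega)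
  rw [q.getVert_zero, zero_add, hq1] at heq
  have hqp := edgeSet_eq_of_mem hG hq hp heq he
  have hqlen := length_eq_of_edgeSet_eq hq hp hqp
  have hactq := activeSet_eq_of_edgeSet_eq (S := S) hp hq hqp
  obtain ⟨s, hs, -⟩ := exists_gateIdx_ne hG hbi hq 0
  refine ⟨q, hq, hqp, lastActive_le hq ⟨_, getVert_gateIdx_mem_activeSet hG.1 hq hs⟩
    fun i hi hi' => ?_⟩
  obtain ⟨j, hj, hj'⟩ := Walk.mem_support_iff_exists_getVert.mp (hact _ (hactq ▸ hi'))
  rw [getVert_eq_of_edgeSet_subset hq hpath (hqp ▸ hsub) (by omega) hq1.symm hj'] at hj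
  exact (getVert_inj hq (by omega) hi hj) ▸ hj'

lemma exists_isFreeEdge_of_isActivePath (hG : G.IsCactus) (hbi : G.IsBiactive S) (hκ : κ ≤ 1)
    (hp : p.IsCycle) {P : G.Walk v b} (hP : G.IsActivePath S p P)
    (hlen : 2 * P.length + 1 + κ ≤ p.length) : ∃ n, s(v, n) ∈ p.edgeSet ∧ IsFreeEdge G S κ v n := by
  obtain ⟨q, hq, hqp, hk⟩ := exists_isCycle_lastActive_le hG hbi hp hP (by omega)
  have hqlen := length_eq_of_edgeSet_eq hq hp hqp
  refine ⟨q.penultimate, ?_, (isFreeEdge_penultimate_iff hG hbi hκ hq).mpr (by omega)⟩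
  rw [← hqp, Sym2.eq_swap]
  exact q.mk_penultimate_end_mem_edges hq.not_nil

lemma exists_isFreeEdge_of_isCritical (hG : G.IsCactus) (hbi : G.IsBiactive S) (hκ : κ ≤ 1)
    (hp : p.IsCycle) (h : IsCritical G S κ p v) :
    ∃ n, s(v, n) ∈ p.edgeSet ∧ IsFreeEdge G S κ v n := by
  obtain ⟨a, b, P, ⟨hP, -⟩, rfl | rfl, hlen⟩ := h
  · exact exists_isFreeEdge_of_isActivePath hG hbi hκ hp hP hlen
  · refine exists_isFreeEdge_of_isActivePath hG hbi hκ hp (P := P.reverse) ?_ (by simpa using hlen)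
    exact ⟨hP.1.reverse, by rw [Walk.edgeSet_reverse]; exact hP.2.1,
      by simpa using hP.2.2.1, by simpa using hP.2.2.2⟩

lemma hasFreePair_of_criticallyIncident (hG : G.IsCactus) (hbi : G.IsBiactive S) (hκ : κ ≤ 1)
    {q : G.Walk v v} (hp : p.IsCycle) (hq : q.IsCycle) (h : CriticallyIncident G S κ p q) :
    HasFreePair G S κ := by
  obtain ⟨hne, w, -, -, hwp, hwq⟩ := h
  obtain ⟨n, hn, hn'⟩ := exists_isFreeEdge_of_isCritical hG hbi hκ hp hwp
  obtain ⟨m, hm, hm'⟩ := exists_isFreeEdge_of_isCritical hG hbi hκ hq hwq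
  refine ⟨w, n, m, ?_, hn', hm'⟩
  rintro rfl
  exact hne (edgeSet_eq_of_mem hG hp hq hn hm)

end Converse

/-! ### Distances on an index cycle -/

lemma cycDist_self (n i : ℕ) : cycDist n i i = 0 := by
  simp only [cycDist]
  omega

lemma cycDist_pos {n i j : ℕ} (hi : i < n) (hj : j < n) (hij : i ≠ j) : 0 < cycDist n i j := by
  simp only [cycDist]
  omega

lemma cycDist_two_mul (n i j : ℕ) : cycDist (2 * n) (2 * i) (2 * j) = 2 * cycDist n i j := by
  simp only [cycDist]
  omega

lemma cycDist_triangle {n i j k : ℕ} (hi : i ≤ n) (hj : j ≤ n) (hk : k ≤ n) :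
    cycDist n i k ≤ cycDist n i j + cycDist n j k := by
  simp only [cycDist]
  omega

lemma cycDist_cases {n i j : ℕ} (hi : i ≤ n) (hj : j ≤ n) :
    (i ≤ j ∧ 2 * j ≤ 2 * i + n ∧ cycDist n i j + i = j) ∨
    (i ≤ j ∧ 2 * i + n < 2 * j ∧ cycDist n i j + j = n + i) ∨
    (j < i ∧ 2 * i ≤ 2 * j + n ∧ cycDist n i j + j = i) ∨
    (j < i ∧ 2 * j + n < 2 * i ∧ cycDist n i j + i = n + j) := by
  simp only [cycDist]
  omega

section Index

variable {g k i t P P' H H' : ℕ}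

lemma cycDist_add_le_succ (hκ : κ ≤ 1) (hi : i < g) (ht : t < g) (hP' : P' < 2 * g)
    (heven : κ = 1 → Even P') (hdir : (2 * i < P' ∧ P' ≤ 2 * i + g) ∨ P' + g ≤ 2 * i)
    (h : cycDist (2 * g) (2 * t) P' =
      cycDist (2 * g) (2 * t) (2 * i) + cycDist (2 * g) (2 * i) P') :
    cycDist g t i + κ ≤ cycDist g t (i + 1) := by
  rw [Nat.even_iff] at heven
  rw [cycDist_two_mul] at h
  have hP := cycDist_cases (n := 2 * g) (i := 2 * t) (j := P') (by omega) hP'.le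
  have hiP := cycDist_cases (n := 2 * g) (i := 2 * i) (j := P') (by omega) hP'.le
  have hti := cycDist_cases (n := g) (i := t) (j := i) ht.le hi.le
  have hsucc := cycDist_cases (n := g) (i := t) (j := i + 1) ht.le hi
  rcases hti with hti | hti | hti | hti <;> rcases hiP with hiP | hiP | hiP | hiP <;> omega

lemma cycDist_add_le_pred (hκ : κ ≤ 1) (hi1 : 1 ≤ i) (hi : i ≤ g) (ht : t < g) (hP' : P' < 2 * g)
    (heven : κ = 1 → Even P') (hne : P' ≠ 2 * i) (hne' : P' + 2 * g ≠ 2 * i)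
    (hdir : ¬ ((2 * i < P' ∧ P' ≤ 2 * i + g) ∨ P' + g ≤ 2 * i))
    (h : cycDist (2 * g) (2 * t) P' =
      cycDist (2 * g) (2 * t) (2 * i) + cycDist (2 * g) (2 * i) P') :
    cycDist g t i + κ ≤ cycDist g t (i - 1) := by
  rw [Nat.even_iff] at heven
  rw [cycDist_two_mul] at h
  have hP := cycDist_cases (n := 2 * g) (i := 2 * t) (j := P') (by omega) hP'.le
  have hiP := cycDist_cases (n := 2 * g) (i := 2 * i) (j := P') (by omega) hP'.le
  have hti := cycDist_cases (n := g) (i := t) (j := i) ht.le hi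
  have hpred := cycDist_cases (n := g) (i := t) (j := i - 1) ht.le (by omega)
  rcases hti with hti | hti | hti | hti <;> rcases hiP with hiP | hiP | hiP | hiP <;> omega

-- On a cycle of length `2 * g` a position `x` is equidistant from the objects at `(P, H)` and
-- `(P', H')` only if it lies halfway between them along one of the two arcs.
lemma cycDist_balanced (hk0 : 0 < k) (hkg : k < g) (hP : P < 2 * g) (hP' : P' < 2 * g)
    (hH : H' ≤ H) (hlt : H < H' + cycDist (2 * g) P P')
    (h0 : cycDist (2 * g) 0 P + H = cycDist (2 * g) 0 P' + H')
    (hk : cycDist (2 * g) (2 * k) P + H = cycDist (2 * g) (2 * k) P' + H') :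
    P + P' = g + 2 * k ∧ ((P < 2 * k ∧ 2 * k < P' ∧ 2 * k + H = g + H') ∨
      (P' < 2 * k ∧ 2 * k < P ∧ 2 * (g - k) + H = g + H')) := by
  have hzero {Q : ℕ} (hQ : Q < 2 * g) : (Q ≤ g ∧ cycDist (2 * g) 0 Q = Q) ∨
      (g < Q ∧ cycDist (2 * g) 0 Q + Q = 2 * g) := by
    simp only [cycDist]
    omega
  have h0P := hzero hP
  have h0P' := hzero hP'
  have hkP := cycDist_cases (n := 2 * g) (i := 2 * k) (j := P) (by omega) hP.le
  have hkP' := cycDist_cases (n := 2 * g) (i := 2 * k) (j := P') (by omega) hP'.le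
  have hPP' := cycDist_cases (n := 2 * g) (i := P) (j := P') hP.le hP'.le
  have hsides : P + P' = g + 2 * k ∧ ((P < 2 * k ∧ 2 * k < P') ∨ (P' < 2 * k ∧ 2 * k < P)) := by
    rcases h0P with h0P | h0P <;> rcases h0P' with h0P' | h0P' <;>
      rcases hPP' with hPP' | hPP' | hPP' | hPP' <;>
        rcases hkP with hkP | hkP | hkP | hkP <;> rcases hkP' with hkP' | hkP' | hkP' | hkP' <;>
          omega
  clear hPP' hlt
  obtain ⟨hsum, hcase⟩ := hsides
  refine ⟨hsum, hcase.imp (fun h => ⟨h.1, h.2, ?_⟩) fun h => ⟨h.1, h.2, ?_⟩⟩ <;>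
    rcases h0P with h0P | h0P <;> rcases h0P' with h0P' | h0P' <;> omega

lemma cycDist_balanced_unique (hk0 : 0 < k) (hkg : k < g) (hP : P < 2 * g) (hP' : P' < 2 * g)
    (hH : H' ≤ H) (hlt : H < H' + cycDist (2 * g) P P')
    (h0 : cycDist (2 * g) 0 P + H = cycDist (2 * g) 0 P' + H')
    (hk : cycDist (2 * g) (2 * k) P + H = cycDist (2 * g) (2 * k) P' + H') (htg : t < g)
    (ht : cycDist (2 * g) (2 * t) P + H = cycDist (2 * g) (2 * t) P' + H') : t = 0 ∨ t = k := by
  by_contra! hne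
  have hkbal := cycDist_balanced hk0 hkg hP hP' hH hlt h0 hk
  have htbal := cycDist_balanced (by omega) htg hP hP' hH hlt h0 ht
  omega

end Index

/-! ### Objects located at a cycle -/

section Located

variable {u a b c x : V} {p : G.Walk u u}

/-- The doubled distance along the cycle `p` from the gate of `s` to the position `P`. Doubling
gives the edge `v_i v_{i+1}` the position `2 * i + 1`, halfway between the positions `2 * i` and
`2 * i + 2` of its ends. -/
noncomputable def posDist (p : G.Walk u u) (s : V) (P : ℕ) : ℕ :=
  cycDist (2 * p.length) (2 * gateIdx p s) P

/-- `D`, a doubled distance to some vertex or edge, is that of an object hanging at height `H` above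
the position `P` of the cycle `p`; vertices with their gate at `P` may be nearer to the object. -/
structure IsLocated (p : G.Walk u u) (D : V → ℕ) (P H : ℕ) : Prop where
  lt : P < 2 * p.length
  le : ∀ s, D s ≤ 2 * G.dist s (p.getVert (gateIdx p s)) + posDist p s P + H
  eq : ∀ s, 2 * gateIdx p s ≠ P →
    D s = 2 * G.dist s (p.getVert (gateIdx p s)) + posDist p s P + H

lemma posDist_two_mul (p : G.Walk u u) (s : V) (i : ℕ) :
    posDist p s (2 * i) = 2 * cycDist p.length (gateIdx p s) i :=
  cycDist_two_mul ..

lemma posDist_of_eq {s : V} {P : ℕ} (h : 2 * gateIdx p s = P) (Q : ℕ) :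
    posDist p s Q = cycDist (2 * p.length) P Q := by
  rw [posDist, h]

lemma posDist_le {s : V} {P P' : ℕ} (hG : G.Connected) (hp : p.IsCycle) (hP : P < 2 * p.length)
    (hP' : P' < 2 * p.length) : posDist p s P' ≤ posDist p s P + cycDist (2 * p.length) P P' := by
  have := gateIdx_lt hG hp s
  exact cycDist_triangle (by omega) hP.le hP'.le

lemma edgeDist_mk (s a b : V) : G.edgeDist s s(a, b) = min (G.dist s a) (G.dist s b) := rfl

lemma isLocated_vertex (hG : G.IsCactus) (hp : p.IsCycle) (x : V) :
    IsLocated p (fun s => 2 * G.dist s x) (2 * gateIdx p x)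
      (2 * G.dist (p.getVert (gateIdx p x)) x) := by
  have hx := gateIdx_lt hG.1 hp x
  refine ⟨by omega, fun s => ?_, fun s hs => ?_⟩ <;>
    have hgate := dist_getVert hG hp s hx.le <;> rw [posDist_two_mul]
  · have := hG.1.dist_triangle (u := s) (v := p.getVert (gateIdx p x)) (w := x)
    omega
  · have := dist_eq_of_gateIdx_ne hG hp (s := s) (x := x) (by omega)
    omega

lemma isLocated_edge_of_gateIdx_eq (hG : G.IsCactus) (hp : p.IsCycle)
    (hac : gateIdx p a = gateIdx p c) :
    IsLocated p (fun s => 2 * G.edgeDist s s(a, c) + 1) (2 * gateIdx p a)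
      (2 * G.edgeDist (p.getVert (gateIdx p a)) s(a, c) + 1) := by
  have ha := isLocated_vertex hG hp a
  have hc := isLocated_vertex hG hp c
  rw [← hac] at hc
  refine ⟨ha.lt, fun s => ?_, fun s hs => ?_⟩ <;> simp only [edgeDist_mk]
  · have := ha.le s
    have := hc.le s
    omega
  · have := ha.eq s hs
    have := hc.eq s hs
    omega

lemma isLocated_edge_getVert (hG : G.IsCactus) (hp : p.IsCycle) {i : ℕ} (hi : i < p.length) :
    IsLocated p (fun s => 2 * G.edgeDist s s(p.getVert i, p.getVert (i + 1)) + 1) (2 * i + 1)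
      0 := by
  have key (s : V) : 2 * G.edgeDist s s(p.getVert i, p.getVert (i + 1)) + 1 =
      2 * G.dist s (p.getVert (gateIdx p s)) + posDist p s (2 * i + 1) + 0 := by
    have hs := gateIdx_lt hG.1 hp s
    rw [edgeDist_mk, dist_getVert hG hp s hi.le, dist_getVert hG hp s hi]
    simp only [posDist, cycDist]
    omega
  exact ⟨by omega, fun s => (key s).le, fun s _ => key s⟩

section TwoObjects

variable {D D' : V → ℕ} {P P' H H' : ℕ}

lemma IsLocated.height_eq_of_gateIdx_eq (h : IsLocated p D P H) (h' : IsLocated p D' P' H')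
    (hG : G.IsCactus) (hbi : G.IsBiactive S) (hp : p.IsCycle) (hS : ∀ s ∈ S, D s = D' s)
    (hPP : P ≠ P') {s : V} (hs : s ∈ S) (hsP : 2 * gateIdx p s = P) :
    H = H' + cycDist (2 * p.length) P P' := by
  obtain ⟨t, ht, hts⟩ := exists_gateIdx_ne hG hbi hp (gateIdx p s)
  apply le_antisymm
  · have := h.eq t (by omega)
    have := h'.le t
    have := hS t ht
    have := posDist_le (s := t) hG.1 hp h.lt h'.lt
    omega
  · have := h.le s
    have := h'.eq s (by omega)
    have := hS s hs
    rw [posDist_of_eq hsP, cycDist_self] at *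
    omega

lemma IsLocated.eq_of_height_eq (h : IsLocated p D P H) (h' : IsLocated p D' P' H')
    (hG : G.IsCactus) (hp : p.IsCycle) (hPP : P ≠ P') (hH : H = H' + cycDist (2 * p.length) P P')
    {s : V} (hs : D s = D' s) :
    D s = 2 * G.dist s (p.getVert (gateIdx p s)) + posDist p s P + H ∧
      posDist p s P' = posDist p s P + cycDist (2 * p.length) P P' := by
  have htri := posDist_le (s := s) hG.1 hp h.lt h'.lt
  by_cases hsP : 2 * gateIdx p s = P
  · have := h'.eq s (by omega)
    rw [posDist_of_eq hsP, posDist_of_eq hsP, cycDist_self] at *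
    omega
  · have := h.eq s hsP
    have := h'.le s
    omega

lemma IsLocated.gateIdx_ne (h : IsLocated p D P H) (h' : IsLocated p D' P' H') (hPP : P ≠ P')
    (hHH : H' ≤ H) {s : V} (hs : D s = D' s) (hsP : 2 * gateIdx p s ≠ P) :
    2 * gateIdx p s ≠ P' := by
  intro hsP'
  have hpos := cycDist_pos h'.lt h.lt hPP.symm
  have := h.eq s hsP
  have := h'.le s
  rw [posDist_of_eq hsP'] at *
  rw [cycDist_self] at *
  omega

lemma IsLocated.eq_or_balanced (h : IsLocated p D P H) (h' : IsLocated p D' P' H')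
    (hG : G.IsCactus) (hbi : G.IsBiactive S) (hp : p.IsCycle) (hS : ∀ s ∈ S, D s = D' s)
    (hPP : P ≠ P') (hHH : H' ≤ H) :
    H = H' + cycDist (2 * p.length) P P' ∨
      H < H' + cycDist (2 * p.length) P P' ∧ ∀ s ∈ S, 2 * gateIdx p s ≠ P ∧
        2 * gateIdx p s ≠ P' ∧ posDist p s P + H = posDist p s P' + H' := by
  refine or_iff_not_imp_left.mpr fun hH => ?_
  have hP (s : V) (hs : s ∈ S) : 2 * gateIdx p s ≠ P := fun hsP =>
    hH (h.height_eq_of_gateIdx_eq h' hG hbi hp hS hPP hs hsP)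
  have hbal (s : V) (hs : s ∈ S) : 2 * gateIdx p s ≠ P' ∧
      posDist p s P + H = posDist p s P' + H' := by
    have hP' := h.gateIdx_ne h' hPP hHH (hS s hs) (hP s hs)
    have := h.eq s (hP s hs)
    have := h'.eq s hP'
    have := hS s hs
    exact ⟨hP', by omega⟩
  refine ⟨?_, fun s hs => ⟨hP s hs, hbal s hs⟩⟩
  obtain ⟨s, hs, -⟩ := exists_gateIdx_ne hG hbi hp 0
  have := (hbal s hs).2
  have := posDist_le (s := s) hG.1 hp h.lt h'.lt
  omega

end TwoObjects

-- The free edge is the first one on the way from `v_i` to `P'` along the cycle.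
lemma exists_isFreeEdge_of_posDist (hG : G.IsCactus) (hκ : κ ≤ 1) (hp : p.IsCycle) {i P' : ℕ}
    (hi : i < p.length) (hP' : P' < 2 * p.length) (hne : 2 * i ≠ P') (heven : κ = 1 → Even P')
    (h : ∀ s ∈ S, posDist p s P' = posDist p s (2 * i) + cycDist (2 * p.length) (2 * i) P') :
    ∃ b, gateIdx p b ≠ i ∧ IsFreeEdge G S κ (p.getVert i) b := by
  suffices h' : ∃ i' ≤ p.length, p.getVert i' = p.getVert i ∧ ∃ j ≤ p.length,
      G.Adj (p.getVert i') (p.getVert j) ∧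
        ∀ s ∈ S, cycDist p.length (gateIdx p s) i' + κ ≤ cycDist p.length (gateIdx p s) j by
    obtain ⟨i', hi', heq, j, hj, hadj, hd⟩ := h'
    rw [heq] at hadj
    refine ⟨p.getVert j, fun hg => hadj.ne ?_, hadj, fun s hs => ?_⟩
    · rw [← hg, getVert_gateIdx hG hp (p.getVert_mem_support j)]
    · rw [← heq, dist_getVert hG hp s hi', dist_getVert hG hp s hj]
      have := hd s hs
      omega
  by_cases hdir : (2 * i < P' ∧ P' ≤ 2 * i + p.length) ∨ P' + p.length ≤ 2 * i
  · exact ⟨i, hi.le, rfl, i + 1, hi, p.adj_getVert_succ hi, fun s hs =>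
      cycDist_add_le_succ hκ hi (gateIdx_lt hG.1 hp s) hP' heven hdir (h s hs)⟩
  -- Going backwards from `v_0` means starting at `v_g`.
  obtain ⟨i', hi', heq, hlen⟩ : ∃ i', (i ≠ 0 ∧ i' = i ∨ i = 0 ∧ i' = p.length) ∧
      p.getVert i' = p.getVert i ∧ 1 ≤ i' ∧ i' ≤ p.length := by
    rcases Nat.eq_zero_or_pos i with rfl | h0
    · exact ⟨p.length, by omega, by simp, by omega, le_rfl⟩
    · exact ⟨i, by omega, rfl, h0, hi.le⟩
  have hadj := p.adj_getVert_succ (i := i' - 1) (by omega)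
  rw [Nat.sub_add_cancel hlen.1] at hadj
  refine ⟨i', hlen.2, heq, i' - 1, by omega, hadj.symm, fun s hs => ?_⟩
  have hs' := gateIdx_lt hG.1 hp s
  refine cycDist_add_le_pred hκ hlen.1 hlen.2 hs' hP' heven (by omega) (by omega) (by omega) ?_
  have hsi := h s hs
  rcases hi' with ⟨-, rfl⟩ | ⟨rfl, rfl⟩
  · exact hsi
  · simp only [posDist, cycDist] at hsi ⊢
    omega

/-! ### Cycles with two active vertices -/

lemma activeSet_eq_pair (hG : G.IsCactus) (hp : p.IsCycle) (hu : u ∈ G.activeSet S p) {s : V}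
    (hs : s ∈ S) (h : ∀ t ∈ S, gateIdx p t = 0 ∨ gateIdx p t = gateIdx p s) :
    G.activeSet S p = {u, p.getVert (gateIdx p s)} := by
  refine Set.Subset.antisymm (fun v hv => ?_)
    (Set.pair_subset hu (getVert_gateIdx_mem_activeSet hG.1 hp hs))
  obtain ⟨i, hi, rfl⟩ := exists_getVert_eq hp hv.1
  obtain ⟨t, ht, rfl⟩ := (getVert_mem_activeSet_iff hG hp hi).mp hv
  rcases h t ht with h | h <;> simp [h]

lemma lastActive_eq_of_activeSet_eq_pair (hp : p.IsCycle) {k : ℕ} (hk : k < p.length)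
    (h : G.activeSet S p = {u, p.getVert k}) : G.lastActive S p = k := by
  refine le_antisymm (lastActive_le hp ⟨u, by simp [h]⟩ fun i hi hact => ?_)
    (le_lastActive hk (by simp [h]))
  rw [h] at hact
  rcases hact with hact | hact
  · have := getVert_inj hp hi (by omega) (hact.trans p.getVert_zero.symm)
    omega
  · exact (getVert_inj hp hi hk hact).le

lemma exists_isCycle_lastActive_eq_sub (hp : p.IsCycle) {k : ℕ} (hk0 : 0 < k) (hk : k < p.length)
    (h : G.activeSet S p = {u, p.getVert k}) :
    ∃ q : G.Walk (p.getVert k) (p.getVert k), q.IsCycle ∧ q.length = p.length ∧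
      G.activeSet S q = G.activeSet S p ∧ G.lastActive S q = p.length - k ∧
      (∀ i, i + k ≤ p.length → q.getVert i = p.getVert (i + k)) ∧
      ∀ i, p.length ≤ i + k → i ≤ p.length → q.getVert i = p.getVert (i + k - p.length) := by
  obtain ⟨q, hq, hedge, hlen, hlow, hhigh⟩ := exists_isCycle_getVert hp hk
  have hact := activeSet_eq_of_edgeSet_eq (S := S) hp hq hedge
  have hqk : q.getVert (p.length - k) = u := by
    rw [hlow _ (by omega), Nat.sub_add_cancel hk.le, p.getVert_length]
  exact ⟨q, hq, hlen, hact, lastActive_eq_of_activeSet_eq_pair hq (by omega)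
    (by rw [hact, hqk, h, Set.pair_comm]), hlow, hhigh⟩

-- Two objects in balance lie on different arcs between the two active vertices; the canonical
-- labelling is the one whose initial arc `v_0 ⋯ v_k` carries the higher object.
lemma exists_isCanonicalCycle_of_balanced (hG : G.IsCactus) (hbi : G.IsBiactive S)
    (hp : p.IsCycle) (hu : u ∈ G.activeSet S p) {P P' H H' : ℕ} (hP : P < 2 * p.length)
    (hP' : P' < 2 * p.length) (hHH : H' ≤ H) (hlt : H < H' + cycDist (2 * p.length) P P')
    (h : ∀ s ∈ S, posDist p s P + H = posDist p s P' + H') :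
    ∃ (w : V) (q : G.Walk w w), G.IsCanonicalCycle S q ∧ q.length = p.length ∧
      (G.activeSet S q).encard = 2 ∧ 2 * G.lastActive S q + H = p.length + H' ∧
      ∀ a, P = 2 * a → ∃ i ≤ G.lastActive S q, q.getVert i = p.getVert a ∧
        ∀ a', P' = 2 * a' →
          q.getVert (q.length / 2 + G.lastActive S q - i) = p.getVert a' := by
  have hlen := hp.three_le_length
  obtain ⟨s₀, hs₀, hgate₀⟩ := (getVert_mem_activeSet_iff (S := S) hG hp (i := 0) (by omega)).mp
    (by rwa [p.getVert_zero])
  obtain ⟨s, hs, hgate⟩ := exists_gateIdx_ne hG hbi hp 0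
  have hk := gateIdx_lt hG.1 hp s
  have hbal₀ := h s₀ hs₀
  simp only [posDist, hgate₀, mul_zero] at hbal₀
  obtain ⟨hsum, hcase⟩ := cycDist_balanced (by omega) hk hP hP' hHH hlt hbal₀ (h s hs)
  have hact := activeSet_eq_pair hG hp hu hs fun t ht => cycDist_balanced_unique (by omega) hk hP
    hP' hHH hlt hbal₀ (h s hs) (gateIdx_lt hG.1 hp t) (h t ht)
  set k := gateIdx p s
  have huk : u ≠ p.getVert k := fun he => hgate
    (getVert_inj hp (i := 0) (by omega) hk (p.getVert_zero.trans he)).symm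
  have hcard : (G.activeSet S p).encard = 2 := by rw [hact, Set.encard_pair huk]
  rcases hcase with ⟨hPk, hkP', hδ⟩ | ⟨-, hkP, hδ⟩
  · have hlast := lastActive_eq_of_activeSet_eq_pair hp hk hact
    refine ⟨u, p, isCanonicalCycle_of_two_mul_lastActive_le hG hp hu (by omega), rfl, hcard,
      by omega, fun a ha => ⟨a, by omega, rfl, fun a' ha' => ?_⟩⟩
    congr 1
    omega
  · obtain ⟨q, hq, hlenq, hactq, hlast, hlow, hhigh⟩ :=
      exists_isCycle_lastActive_eq_sub hp (by omega) hk hact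
    refine ⟨_, q, isCanonicalCycle_of_two_mul_lastActive_le hG hq (by simp [hactq, hact])
      (by omega), hlenq, by rw [hactq, hcard], by omega, fun a ha => ⟨a - k, by omega, ?_,
        fun a' ha' => ?_⟩⟩
    · rw [hlow _ (by omega)]
      congr 1
      omega
    · rw [hlast, hhigh _ (by omega) (by omega)]
      congr 1
      omega

/-! ### Threads at inactive vertices of a cycle -/

lemma exists_isPathSide_of_notMem_activeSet [Finite V] [G.LocallyFinite] (hG : G.IsCactus)
    (hbi : G.IsBiactive S) (hbr : G.IsBranchResolving S) (hp : p.IsCycle)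
    (hu : u ∉ G.activeSet S p) (hadj : G.Adj u b) (hb : s(u, b) ∉ p.edgeSet) :
    G.IsBridge s(u, b) ∧ ∃ l, G.IsFreeThread S u l ∧ IsPathSide G u b l := by
  have hbridge : G.IsBridge s(u, b) := by
    by_contra hnb
    obtain ⟨q, hq, rfl⟩ := exists_isCycle_of_not_isBridge hadj hnb
    exact hu (start_mem_activeSet hG hbi hp hq fun h =>
      hb (h ▸ q.mk_start_snd_mem_edges hq.not_nil))
  have hgate : gateIdx p b = 0 := by rw [← gateIdx_eq_of_adj hG hp hadj hb, gateIdx_start hG hp]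
  have hfree : Disjoint (side G u b) S := Set.disjoint_left.mpr fun y hy hyS => by
    have hne : gateIdx p y ≠ gateIdx p b := fun h => hu <| by
      simpa [h, hgate] using getVert_gateIdx_mem_activeSet hG.1 hp hyS
    have hd := dist_eq_of_gateIdx_ne hG hp hne
    rw [hgate, p.getVert_zero] at hd
    have := dist_of_mem_side hG.1 hbridge hy
    omega
  obtain ⟨l, hl⟩ := exists_isPathSide hG hbi hbr hbridge hfree
  have hne {y : V} (hy : s(u, y) ∈ p.edges) : b ≠ y := by
    rintro rfl
    exact hb hy
  have hpen := p.mk_penultimate_end_mem_edges hp.not_nil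
  rw [Sym2.eq_swap] at hpen
  have hdeg : 3 ≤ G.degree u := three_le_degree hadj (p.adj_snd hp.not_nil)
    (p.adj_penultimate hp.not_nil).symm (hne (p.mk_start_snd_mem_edges hp.not_nil)) (hne hpen)
    hp.snd_ne_penultimate
  exact ⟨hbridge, l, hl.isFreeThread hG.1 hbridge hdeg hfree, hl⟩

lemma exists_adj_gateIdx (hG : G.IsCactus) (hp : p.IsCycle) (hx : x ≠ p.getVert (gateIdx p x)) :
    ∃ b, G.Adj (p.getVert (gateIdx p x)) b ∧ gateIdx p b = gateIdx p x ∧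
      G.dist b x + 1 = G.dist (p.getVert (gateIdx p x)) x := by
  obtain ⟨b, hb, hd⟩ := exists_adj_dist_add_one hG.1 hx.symm
  refine ⟨b, hb, ?_, hd⟩
  by_contra hne
  have := dist_eq_of_gateIdx_ne hG hp hne
  omega

lemma exists_isPathSide_gateIdx [Finite V] [G.LocallyFinite] (hG : G.IsCactus)
    (hbi : G.IsBiactive S) (hbr : G.IsBranchResolving S) (hp : p.IsCycle)
    (hin : p.getVert (gateIdx p x) ∉ G.activeSet S p) (hx : x ≠ p.getVert (gateIdx p x)) :
    ∃ b l, x ∈ side G (p.getVert (gateIdx p x)) b ∧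
      G.IsFreeThread S (p.getVert (gateIdx p x)) l ∧
      IsPathSide G (p.getVert (gateIdx p x)) b l := by
  obtain ⟨b, hadj, hgate, hd⟩ := exists_adj_gateIdx hG hp hx
  obtain ⟨q, hq, hedge, -, -, -⟩ := exists_isCycle_getVert hp (gateIdx_lt hG.1 hp x)
  have hb : s(p.getVert (gateIdx p x), b) ∉ q.edgeSet := fun he => by
    have hmem := getVert_gateIdx hG hp (p.snd_mem_support_of_mem_edges (hedge ▸ he))
    exact hadj.ne (hgate ▸ hmem)
  rw [← activeSet_eq_of_edgeSet_eq hp hq hedge] at hin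
  obtain ⟨hbridge, l, hl, hl'⟩ := exists_isPathSide_of_notMem_activeSet hG hbi hbr hq hin hadj hb
  refine ⟨b, l, mem_side_of_dist_le hG.1 hbridge ?_, hl, hl'⟩
  rw [dist_comm, dist_comm (u := x)]
  omega

lemma exists_isFreeThread_dist_le [Finite V] [G.LocallyFinite] (hG : G.IsCactus)
    (hbi : G.IsBiactive S) (hbr : G.IsBranchResolving S) (hp : p.IsCycle)
    (hin : p.getVert (gateIdx p x) ∉ G.activeSet S p) (hx : x ≠ p.getVert (gateIdx p x)) :
    ∃ l, G.IsFreeThread S (p.getVert (gateIdx p x)) l ∧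
      G.dist (p.getVert (gateIdx p x)) x ≤ l.length := by
  obtain ⟨b, l, hside, hl, hl'⟩ := exists_isPathSide_gateIdx hG hbi hbr hp hin hx
  exact ⟨l, hl, hl'.dist_le hside⟩

lemma exists_isFreeThread_edgeDist_lt [Finite V] [G.LocallyFinite] (hG : G.IsCactus)
    (hbi : G.IsBiactive S) (hbr : G.IsBranchResolving S) (hp : p.IsCycle) (hac : G.Adj a c)
    (hgate : gateIdx p a = gateIdx p c) (hin : p.getVert (gateIdx p a) ∉ G.activeSet S p) :
    ∃ l, G.IsFreeThread S (p.getVert (gateIdx p a)) l ∧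
      G.edgeDist (p.getVert (gateIdx p a)) s(a, c) < l.length := by
  wlog hle : G.dist (p.getVert (gateIdx p a)) a ≤ G.dist (p.getVert (gateIdx p a)) c
    generalizing a c
  · rw [hgate, Sym2.eq_swap]
    exact this hac.symm hgate.symm (by rwa [← hgate]) (by rw [← hgate]; omega)
  have hcw : c ≠ p.getVert (gateIdx p a) := by
    rintro h
    rw [← h, dist_self, Nat.le_zero, hG.1.dist_eq_zero_iff] at hle
    exact hac.ne hle.symm
  rw [hgate] at hin hcw hle ⊢
  obtain ⟨b, l, hc, hl, hl'⟩ := exists_isPathSide_gateIdx hG hbi hbr hp hin hcw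
  refine ⟨l, hl, ?_⟩
  rw [edgeDist_mk, min_eq_left hle]
  refine (hle.lt_of_ne fun heq => ?_).trans_le (hl'.dist_le hc)
  have haw : a ≠ p.getVert (gateIdx p c) := by
    rintro h
    rw [← h, dist_self, eq_comm, hG.1.dist_eq_zero_iff] at heq
    exact hac.ne heq
  have ha := mem_side_of_adj hc hac.symm fun h => (Sym2.eq_iff.mp h).elim (hcw ·.1) (haw ·.2)
  exact hac.ne (hl'.dist_inj ha hc heq)

/-! ### Free edges away from a cycle -/

lemma exists_isFreeEdge_of_dist_eq (hG : G.IsCactus) (hp : p.IsCycle)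
    (hx : x ≠ p.getVert (gateIdx p x))
    (h : ∀ s ∈ S, G.dist s x = G.dist s (p.getVert (gateIdx p x)) +
      G.dist (p.getVert (gateIdx p x)) x) :
    ∃ b, gateIdx p b = gateIdx p x ∧ IsFreeEdge G S 1 (p.getVert (gateIdx p x)) b := by
  obtain ⟨b, hadj, hb, hd⟩ := exists_adj_gateIdx hG hp hx
  refine ⟨b, hb, hadj, fun s hs => ?_⟩
  have := h s hs
  have := hG.1.dist_triangle (u := s) (v := b) (w := x)
  omega

lemma exists_isFreeEdge_of_edgeDist_eq (hG : G.IsCactus) (hp : p.IsCycle) (hac : G.Adj a c)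
    (hgate : gateIdx p a = gateIdx p c)
    (h : ∀ s ∈ S, G.edgeDist s s(a, c) = G.dist s (p.getVert (gateIdx p a)) +
      G.edgeDist (p.getVert (gateIdx p a)) s(a, c)) :
    ∃ b, gateIdx p b = gateIdx p a ∧ IsFreeEdge G S 0 (p.getVert (gateIdx p a)) b := by
  wlog hle : G.dist (p.getVert (gateIdx p a)) a ≤ G.dist (p.getVert (gateIdx p a)) c
    generalizing a c
  · rw [hgate]
    exact this hac.symm hgate.symm (by rwa [← hgate, Sym2.eq_swap]) (by rw [← hgate]; omega)
  simp only [edgeDist_mk, min_eq_left hle] at h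
  by_cases ha : a = p.getVert (gateIdx p a)
  · refine ⟨c, hgate.symm, ha ▸ hac, fun s hs => ?_⟩
    have := h s hs
    omega
  · obtain ⟨b, hb, hf⟩ := exists_isFreeEdge_of_dist_eq (S := S) hG hp ha fun s hs => by
      have := h s hs
      have := hG.1.dist_triangle (u := s) (v := p.getVert (gateIdx p a)) (w := a)
      omega
    exact ⟨b, hb, hf.1, fun s hs => by have := hf.2 s hs; omega⟩

end Located

/-! ### Pairs that no cycle separates -/

lemma HasFreePair.mono {κ' : ℕ} (h : HasFreePair G S κ) (hκ : κ' ≤ κ) : HasFreePair G S κ' := by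
  obtain ⟨w, b, c, hne, hb, hc⟩ := h
  exact ⟨w, b, c, hne, ⟨hb.1, fun s hs => (Nat.add_le_add_left hκ _).trans (hb.2 s hs)⟩,
    ⟨hc.1, fun s hs => (Nat.add_le_add_left hκ _).trans (hc.2 s hs)⟩⟩

lemma hasFreePair_empty [G.LocallyFinite] (hbi : G.IsBiactive ∅)
    (hpath : ¬ (G.IsAcyclic ∧ ∀ v, G.degree v ≤ 2)) : HasFreePair G ∅ κ := by
  have hacyclic : G.IsAcyclic := fun u p hp => by simpa [activeSet] using hbi u p hp
  obtain ⟨v, hv⟩ : ∃ v, 2 < G.degree v := by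
    by_contra! h
    exact hpath ⟨hacyclic, h⟩
  obtain ⟨b, c, hb, hc, hne⟩ := Finset.one_lt_card_iff.mp
    ((one_lt_two.trans hv).trans_eq (G.card_neighborFinset_eq_degree v).symm)
  rw [mem_neighborFinset] at hb hc
  exact ⟨v, b, c, hne, ⟨hb, by simp⟩, ⟨hc, by simp⟩⟩

section Unseparated

variable {a b c d s v w x x' y z : V}

lemma exists_dist_eq (hG : G.Connected) {m : ℕ} (hm : m ≤ G.dist x y) :
    ∃ w, G.dist x w = m ∧ m + G.dist w y = G.dist x y := by
  obtain ⟨q, hq⟩ := hG.exists_walk_length_eq_dist x y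
  have hx := dist_getVert_le q 0 m
  have hy := dist_getVert_le q m q.length
  have htri := hG.dist_triangle (u := x) (v := q.getVert m) (w := y)
  rw [q.getVert_zero] at hx
  rw [q.getVert_length] at hy
  exact ⟨q.getVert m, by omega, by omega⟩

lemma eq_getVert_gateIdx_of_dist_add (hG : G.IsCactus) {u : V} {p : G.Walk u u} (hp : p.IsCycle)
    (hxy : gateIdx p x = gateIdx p y) (hv : v ∈ p.support)
    (hd : G.dist x v + G.dist v y = G.dist x y) : v = p.getVert (gateIdx p x) := by
  by_contra hne
  have hgate : gateIdx p v ≠ gateIdx p x := fun h =>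
    hne (by rw [← h, getVert_gateIdx hG hp hv])
  have hvx := dist_eq_of_gateIdx_ne hG hp hgate
  have hvy := dist_eq_of_gateIdx_ne hG hp (hxy ▸ hgate)
  rw [← hxy] at hvy
  have htri := hG.1.dist_triangle (u := x) (v := p.getVert (gateIdx p x)) (w := y)
  have hpos := hG.1.pos_dist_of_ne hne
  rw [dist_comm (u := x) (v := v), hvx, hvy] at hd
  rw [dist_comm (v := p.getVert (gateIdx p x))] at htri
  omega

lemma isBridge_of_dist_add (hG : G.IsCactus)
    (hsep : ∀ (u : V) (p : G.Walk u u), p.IsCycle → gateIdx p x = gateIdx p y)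
    (hadj : G.Adj v w) (hd : G.dist x v + 1 + G.dist w y = G.dist x y) : G.IsBridge s(v, w) := by
  by_contra hnb
  obtain ⟨p, hp, rfl⟩ := exists_isCycle_of_not_isBridge hadj hnb
  have hv := dist_le_dist_add_one hG.1 y hadj.symm
  have hw := dist_le_dist_add_one hG.1 x hadj
  have hvtri := hG.1.dist_triangle (u := x) (v := v) (w := y)
  have hwtri := hG.1.dist_triangle (u := x) (v := p.getVert 1) (w := y)
  rw [dist_comm, dist_comm (u := y)] at hv
  refine hadj.ne ((eq_getVert_gateIdx_of_dist_add hG hp (hsep v p hp) p.start_mem_support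
    (by omega)).trans (eq_getVert_gateIdx_of_dist_add hG hp (hsep v p hp)
      (p.getVert_mem_support 1) (by omega)).symm)

lemma dist_eq_add_one_of_isBridge (hG : G.Connected) (hb : G.IsBridge s(w, b))
    (hs : G.dist s x = G.dist s x') (hx : G.dist b x ≤ G.dist w x')
    (hx' : G.dist x' w ≤ G.dist x' b) : G.dist s b = G.dist s w + 1 := by
  refine (dist_isBridge_cases hG hb s).resolve_right fun h => ?_
  have hd := dist_eq_of_isBridge hG (isBridge_symm hb) (s := s) (by omega) hx'
  have htri := hG.dist_triangle (u := s) (v := b) (w := x)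
  omega

lemma even_dist_of_dist_eq (hG : G.IsCactus) (hs : G.dist s x = G.dist s x')
    (hsep : ∀ (u : V) (p : G.Walk u u), p.IsCycle → gateIdx p x = gateIdx p x') :
    Even (G.dist x x') := by
  rw [← Nat.not_odd_iff_even]
  rintro ⟨m, hm⟩
  obtain ⟨w, hxw, hwx'⟩ := exists_dist_eq hG.1 (show m ≤ G.dist x x' by omega)
  obtain ⟨z, hwz, hzx'⟩ := exists_adj_dist_add_one hG.1 (a := w) (x := x') fun h => by
    rw [h, dist_self] at hwx'
    omega
  have hbridge := isBridge_of_dist_add hG hsep hwz (by omega)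
  have hzx := dist_le_dist_add_one hG.1 x hwz
  have htri := hG.1.dist_triangle (u := x) (v := z) (w := x')
  have hsz := dist_eq_add_one_of_isBridge hG.1 (isBridge_symm hbridge) hs
    (by rw [dist_comm]; omega) (by rw [dist_comm, dist_comm (u := x')]; omega)
  have hsw := dist_eq_add_one_of_isBridge hG.1 hbridge hs.symm (by rw [dist_comm (u := w)]; omega)
    (by omega)
  omega

lemma exists_isFreeEdge_of_dist_add (hG : G.IsCactus) (hwx : 0 < G.dist w x)
    (heq : G.dist w x = G.dist w x') (hadd : G.dist w x + G.dist w x' = G.dist x x')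
    (h : ∀ s ∈ S, G.dist s x = G.dist s x')
    (hsep : ∀ (u : V) (p : G.Walk u u), p.IsCycle → gateIdx p x = gateIdx p x') :
    ∃ b, G.dist b x < G.dist b x' ∧ IsFreeEdge G S 1 w b := by
  obtain ⟨b, hwb, hbx⟩ := exists_adj_dist_add_one hG.1 (a := w) (x := x) fun h => by
    rw [h, dist_self] at hwx
    exact hwx.false
  have hbridge := isBridge_of_dist_add hG hsep hwb.symm
    (by rw [dist_comm (v := b)]; omega)
  have htri := hG.1.dist_triangle (u := x) (v := b) (w := x')
  rw [dist_comm (v := b)] at htri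
  exact ⟨b, by omega, hwb, fun s hs => (dist_eq_add_one_of_isBridge hG.1 (isBridge_symm hbridge)
    (h s hs) (by omega) (by rw [dist_comm, dist_comm (u := x')]; omega)).ge⟩

-- Every edge of a geodesic from `x` to `x'` is a bridge; the two at its midpoint form a free pair.
lemma hasFreePair_of_dist_eq (hG : G.IsCactus) (hS : S.Nonempty) (hxx' : x ≠ x')
    (h : ∀ s ∈ S, G.dist s x = G.dist s x')
    (hsep : ∀ (u : V) (p : G.Walk u u), p.IsCycle → gateIdx p x = gateIdx p x') :
    HasFreePair G S 1 := by
  obtain ⟨s, hs⟩ := hS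
  obtain ⟨m, hm⟩ := even_dist_of_dist_eq hG (h s hs) hsep
  have hpos := hG.1.pos_dist_of_ne hxx'
  obtain ⟨w, hxw, hwx'⟩ := exists_dist_eq hG.1 (show m ≤ G.dist x x' by omega)
  rw [dist_comm] at hxw
  obtain ⟨b, hb, hfb⟩ := exists_isFreeEdge_of_dist_add (S := S) hG (w := w) (by omega) (by omega)
    (by omega) h hsep
  obtain ⟨c, hc, hfc⟩ := exists_isFreeEdge_of_dist_add (S := S) hG (w := w) (x := x') (x' := x)
    (by omega) (by omega) (by rw [dist_comm (u := x')]; omega) (fun s hs => (h s hs).symm)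
    fun u p hp => (hsep u p hp).symm
  exact ⟨w, b, c, fun hbc => hb.asymm (hbc ▸ hc), hfb, hfc⟩

lemma mem_side_or_mem_side_of_adj (hG : G.Connected) (hcd : G.Adj c d)
    (hne : s(c, d) ≠ s(a, b)) :
    (c ∈ side G b a ∧ d ∈ side G b a) ∨ (c ∈ side G a b ∧ d ∈ side G a b) :=
  (mem_side_or_mem_side hG a b c).imp
    (fun h => ⟨h, mem_side_of_adj h hcd (by rwa [Sym2.eq_swap (a := b)])⟩)
    fun h => ⟨h, mem_side_of_adj h hcd hne⟩

lemma mem_side_of_edgeDist_le (hG : G.Connected) (hb : G.IsBridge s(a, b)) (hc : c ∈ side G a b)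
    (hd : d ∈ side G a b) (h : G.edgeDist s s(c, d) ≤ G.edgeDist s s(a, b)) : s ∈ side G a b := by
  refine (mem_side_or_mem_side hG a b s).resolve_left fun hs => ?_
  have hsc := dist_of_mem_side_of_mem_side hG hb hs hc
  have hsd := dist_of_mem_side_of_mem_side hG hb hs hd
  rw [edgeDist_mk, edgeDist_mk] at h
  omega

lemma hasFreePair_of_edgeDist_eq (hG : G.IsCactus) (hS : S.Nonempty) (hab : G.IsBridge s(a, b))
    (hcd : G.IsBridge s(c, d)) (hne : s(a, b) ≠ s(c, d))
    (h : ∀ s ∈ S, G.edgeDist s s(a, b) = G.edgeDist s s(c, d))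
    (hsep : ∀ (u : V) (p : G.Walk u u), p.IsCycle → gateIdx p a = gateIdx p c) :
    HasFreePair G S 0 := by
  wlog hb : c ∈ side G a b ∧ d ∈ side G a b generalizing a b
  · refine this (isBridge_symm hab) (by rwa [Sym2.eq_swap]) (by rwa [Sym2.eq_swap (a := b)])
      (fun u p hp => ?_) ((mem_side_or_mem_side_of_adj hG.1 (adj_of_isBridge hG.1 hcd)
        hne.symm).resolve_right hb)
    rw [← hsep u p hp]
    exact (gateIdx_eq_of_adj hG hp (adj_of_isBridge hG.1 hab)
      (hab.notMem_edges_of_isCycle hp)).symm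
  wlog hd : a ∈ side G c d ∧ b ∈ side G c d generalizing c d
  · refine this (isBridge_symm hcd) (by rwa [Sym2.eq_swap (a := d)])
      (by rwa [Sym2.eq_swap (a := d)]) (fun u p hp => ?_) hb.symm
      ((mem_side_or_mem_side_of_adj hG.1 (adj_of_isBridge hG.1 hab) hne).resolve_right hd)
    rw [hsep u p hp]
    exact gateIdx_eq_of_adj hG hp (adj_of_isBridge hG.1 hcd) (hcd.notMem_edges_of_isCycle hp)
  have hac : a ≠ c := fun hac => notMem_side hcd (mem_side_self d c) (hac ▸ hd.1)
  refine (hasFreePair_of_dist_eq hG hS hac (fun s hs => ?_) hsep).mono (Nat.zero_le 1)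
  have hsb := mem_side_of_edgeDist_le hG.1 hab hb.1 hb.2 (h s hs).ge
  have hsd := mem_side_of_edgeDist_le hG.1 hcd hd.1 hd.2 (h s hs).le
  have hsa := dist_of_mem_side hG.1 hab hsb
  have hsc := dist_of_mem_side hG.1 hcd hsd
  have := h s hs
  rw [edgeDist_mk, edgeDist_mk] at this
  omega

end Unseparated

/-! ### Pairs separated by a cycle -/

section Separated

variable {u a b c x x' : V} {p : G.Walk u u} {e f : Sym2 V} {P P' H H' : ℕ}

lemma exists_start_mem_activeSet (hG : G.IsCactus) (hbi : G.IsBiactive S) (hp : p.IsCycle) :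
    ∃ (w : V) (q : G.Walk w w), q.IsCycle ∧ q.edgeSet = p.edgeSet ∧ w ∈ G.activeSet S q := by
  obtain ⟨s, hs, -⟩ := exists_gateIdx_ne hG hbi hp 0
  obtain ⟨q, hq, hqe, -⟩ := exists_isCycle_getVert hp (gateIdx_lt hG.1 hp s)
  refine ⟨_, q, hq, hqe, ?_⟩
  rw [activeSet_eq_of_edgeSet_eq hp hq hqe]
  exact getVert_gateIdx_mem_activeSet hG.1 hp hs

lemma gateIdx_eq_iff (hG : G.IsCactus) (hp : p.IsCycle) (x y : V) :
    gateIdx p x = gateIdx p y ↔ (G.deleteEdges p.edgeSet).Reachable x y := by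
  refine ⟨fun h => ?_, gateIdx_eq_of_reachable hG hp⟩
  have hx := reachable_gateIdx hG.1 hp x
  rw [h] at hx
  exact hx.symm.trans (reachable_gateIdx hG.1 hp y)

lemma getVert_notMem_activeSet (hG : G.IsCactus) (hp : p.IsCycle) {i : ℕ} (hi : i < p.length)
    (h : ∀ s ∈ S, 2 * gateIdx p s ≠ 2 * i) : p.getVert i ∉ G.activeSet S p := by
  rw [getVert_mem_activeSet_iff hG hp hi]
  rintro ⟨s, hs, rfl⟩
  exact h s hs rfl

lemma hasFreePair_of_posDist (hG : G.IsCactus) (hκ : κ ≤ 1) (hp : p.IsCycle) {i : ℕ}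
    (hi : i < p.length) (hP' : P' < 2 * p.length) (hne : 2 * i ≠ P') (heven : κ = 1 → Even P')
    (h : ∀ s ∈ S, posDist p s P' = posDist p s (2 * i) + cycDist (2 * p.length) (2 * i) P')
    (hb : gateIdx p b = i) (hfree : IsFreeEdge G S κ (p.getVert i) b) : HasFreePair G S κ := by
  obtain ⟨c, hc, hfree'⟩ := exists_isFreeEdge_of_posDist hG hκ hp hi hP' hne heven h
  exact ⟨_, b, c, fun hbc => hc (hbc ▸ hb), hfree, hfree'⟩

lemma exists_config_of_balanced_vertices [Finite V] [G.LocallyFinite] (hG : G.IsCactus)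
    (hbi : G.IsBiactive S) (hbr : G.IsBranchResolving S) (hp : p.IsCycle)
    (hu : u ∈ G.activeSet S p)
    (hHH : 2 * G.dist (p.getVert (gateIdx p x')) x' ≤ 2 * G.dist (p.getVert (gateIdx p x)) x)
    (hlt : 2 * G.dist (p.getVert (gateIdx p x)) x < 2 * G.dist (p.getVert (gateIdx p x')) x' +
      cycDist (2 * p.length) (2 * gateIdx p x) (2 * gateIdx p x'))
    (hbal : ∀ s ∈ S, 2 * gateIdx p s ≠ 2 * gateIdx p x ∧ 2 * gateIdx p s ≠ 2 * gateIdx p x' ∧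
      posDist p s (2 * gateIdx p x) + 2 * G.dist (p.getVert (gateIdx p x)) x =
        posDist p s (2 * gateIdx p x') + 2 * G.dist (p.getVert (gateIdx p x')) x') :
    ∃ (w : V) (q : G.Walk w w), G.IsCanonicalCycle S q ∧ (G.ConfigA S q ∨ G.ConfigC S q) := by
  obtain ⟨w, q, hq, hlen, hcard, hk, hpos⟩ := exists_isCanonicalCycle_of_balanced hG hbi hp hu
    (isLocated_vertex hG hp x).lt (isLocated_vertex hG hp x').lt hHH hlt
    fun s hs => (hbal s hs).2.2
  refine ⟨w, q, hq, ?_⟩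
  rcases hHH.lt_or_eq with hH | hH
  · obtain ⟨i, hi, hqi, -⟩ := hpos _ rfl
    obtain ⟨l, hl, hdist⟩ := exists_isFreeThread_dist_le hG hbi hbr hp (x := x)
      (getVert_notMem_activeSet hG hp (gateIdx_lt hG.1 hp x) fun s hs => (hbal s hs).1) fun h => by
        rw [← h, dist_self] at hH
        omega
    exact .inr ⟨hcard, Nat.even_iff.mpr (by omega), by omega, i, hi, l, hqi ▸ hl, by omega⟩
  · exact .inl ⟨hcard, Nat.even_iff.mpr (by omega), by omega⟩

lemma hasFreePair_or_exists_config_of_gateIdx_ne [Finite V] [G.LocallyFinite] (hG : G.IsCactus)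
    (hbi : G.IsBiactive S) (hbr : G.IsBranchResolving S) (hp : p.IsCycle)
    (hu : u ∈ G.activeSet S p) (hne : gateIdx p x ≠ gateIdx p x')
    (h : ∀ s ∈ S, G.dist s x = G.dist s x') :
    HasFreePair G S 1 ∨ ∃ (w : V) (q : G.Walk w w),
      G.IsCanonicalCycle S q ∧ (G.ConfigA S q ∨ G.ConfigC S q) := by
  wlog hHH : 2 * G.dist (p.getVert (gateIdx p x')) x' ≤ 2 * G.dist (p.getVert (gateIdx p x)) x
    generalizing x x'
  · exact this hne.symm (fun s hs => (h s hs).symm) (by omega)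
  have hloc := isLocated_vertex hG hp x
  have hloc' := isLocated_vertex hG hp x'
  have hPP : 2 * gateIdx p x ≠ 2 * gateIdx p x' := by omega
  have hS (s : V) (hs : s ∈ S) : 2 * G.dist s x = 2 * G.dist s x' := by rw [h s hs]
  refine (hloc.eq_or_balanced hloc' hG hbi hp hS hPP hHH).imp (fun hH => ?_) fun hbal =>
    exists_config_of_balanced_vertices hG hbi hbr hp hu hHH hbal.1 hbal.2
  have hpos := cycDist_pos hloc.lt hloc'.lt hPP
  have heq (s : V) (hs : s ∈ S) := hloc.eq_of_height_eq hloc' hG hp hPP hH (hS s hs)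
  obtain ⟨b, hb, hfree⟩ := exists_isFreeEdge_of_dist_eq (S := S) hG hp (x := x)
    (fun hx => by
      rw [← hx, dist_self] at hH
      omega)
    fun s hs => by
      have := (heq s hs).1
      have := dist_getVert hG hp s (gateIdx_lt hG.1 hp x).le
      rw [posDist_two_mul] at *
      omega
  exact hasFreePair_of_posDist hG le_rfl hp (gateIdx_lt hG.1 hp x) hloc'.lt hPP
    (fun _ => even_two_mul _) (fun s hs => (heq s hs).2) hb hfree

lemma hasFreePair_or_exists_config_of_dist_eq [Finite V] [G.LocallyFinite] (hG : G.IsCactus)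
    (hpath : ¬ (G.IsAcyclic ∧ ∀ v, G.degree v ≤ 2)) (hbi : G.IsBiactive S)
    (hbr : G.IsBranchResolving S) (hxx' : x ≠ x') (h : ∀ s ∈ S, G.dist s x = G.dist s x') :
    HasFreePair G S 1 ∨ ∃ (w : V) (q : G.Walk w w),
      G.IsCanonicalCycle S q ∧ (G.ConfigA S q ∨ G.ConfigC S q) := by
  rcases S.eq_empty_or_nonempty with rfl | hS
  · exact .inl (hasFreePair_empty hbi hpath)
  by_cases! hsep : ∀ (u : V) (p : G.Walk u u), p.IsCycle → u ∈ G.activeSet S p →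
      gateIdx p x = gateIdx p x'
  · refine .inl (hasFreePair_of_dist_eq hG hS hxx' h fun u p hp => ?_)
    obtain ⟨w, q, hq, hqe, hw⟩ := exists_start_mem_activeSet hG hbi hp
    have := hsep w q hq hw
    rwa [gateIdx_eq_iff hG hq, hqe, ← gateIdx_eq_iff hG hp] at this
  · obtain ⟨u, p, hp, hu, hne⟩ := hsep
    exact hasFreePair_or_exists_config_of_gateIdx_ne hG hbi hbr hp hu hne h

/-- The edge `e` is located at the position `P` and the height `H` of the cycle `p`: at the midpoint
`2 * i + 1` of `v_i v_{i+1}` if it lies on `p`, and otherwise above the gate of its ends, at the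
doubled distance from the gate to the midpoint of `e`. -/
inductive EdgeAt (p : G.Walk u u) : Sym2 V → ℕ → ℕ → Prop
  | on_cycle {i : ℕ} (hi : i < p.length) : EdgeAt p s(p.getVert i, p.getVert (i + 1)) (2 * i + 1) 0
  | off_cycle {a c : V} (hac : G.Adj a c) (hoff : s(a, c) ∉ p.edgeSet)
      (hgate : gateIdx p a = gateIdx p c) : EdgeAt p s(a, c) (2 * gateIdx p a)
        (2 * G.edgeDist (p.getVert (gateIdx p a)) s(a, c) + 1)

lemma exists_edgeAt (hG : G.IsCactus) (hp : p.IsCycle) (he : e ∈ G.edgeSet) :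
    ∃ P H, EdgeAt p e P H := by
  induction e with | h a c =>
  by_cases hep : s(a, c) ∈ p.edgeSet
  · obtain ⟨i, hi, h⟩ := p.mk_mem_edges_iff_exists.mp hep
    exact h ▸ ⟨_, _, .on_cycle hi⟩
  · exact ⟨_, _, .off_cycle he hep (gateIdx_eq_of_adj hG hp he hep)⟩

lemma EdgeAt.isLocated (h : EdgeAt p e P H) (hG : G.IsCactus) (hp : p.IsCycle) :
    IsLocated p (fun s => 2 * G.edgeDist s e + 1) P H := by
  rcases h with hi | ⟨hac, hoff, hgate⟩
  · exact isLocated_edge_getVert hG hp hi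
  · exact isLocated_edge_of_gateIdx_eq hG hp hgate

lemma EdgeAt.eq_of_mem (h : EdgeAt p e P H) (h' : EdgeAt p f P' H') (hPP : P = P')
    (he : e ∈ p.edgeSet) : e = f := by
  rcases h with @⟨i, hi⟩ | ⟨-, hoff, -⟩
  · rcases h' with @⟨j, hj⟩ | ⟨-, -, -⟩
    · obtain rfl : i = j := by omega
      rfl
    · omega
  · exact absurd he hoff

lemma EdgeAt.eq_two_mul_gateIdx (h : EdgeAt p e P H) (he : e ∉ p.edgeSet) (ha : a ∈ e) :
    P = 2 * gateIdx p a := by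
  rcases h with hi | ⟨-, -, hgate⟩
  · exact absurd (edge_getVert_mem p hi) he
  · rcases Sym2.mem_iff.mp ha with rfl | rfl
    · rfl
    · rw [hgate]

lemma EdgeAt.odd_and_exists_eq_two_mul (h : EdgeAt p e P H) (hH : 0 < H) :
    Odd H ∧ ∃ i, P = 2 * i := by
  rcases h with hi | ⟨-, -, -⟩
  · omega
  · exact ⟨⟨_, rfl⟩, _, rfl⟩

lemma EdgeAt.exists_isFreeThread [Finite V] [G.LocallyFinite] {i : ℕ} (h : EdgeAt p e P H)
    (hG : G.IsCactus) (hbi : G.IsBiactive S) (hbr : G.IsBranchResolving S) (hp : p.IsCycle)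
    (hP : P = 2 * i) (hin : ∀ s ∈ S, 2 * gateIdx p s ≠ P) :
    ∃ l, G.IsFreeThread S (p.getVert i) l ∧ H < 2 * l.length := by
  rcases h with hi | @⟨a, c, hac, -, hgate⟩
  · omega
  · obtain rfl : gateIdx p a = i := by omega
    obtain ⟨l, hl, hlt⟩ := exists_isFreeThread_edgeDist_lt hG hbi hbr hp hac hgate
      (getVert_notMem_activeSet hG hp (gateIdx_lt hG.1 hp a) hin)
    exact ⟨l, hl, by omega⟩

lemma EdgeAt.exists_isFreeEdge (h : EdgeAt p e P H) (hG : G.IsCactus) (hp : p.IsCycle)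
    (hH : 0 < H) (hd : ∀ s ∈ S, 2 * G.edgeDist s e + 1 =
      2 * G.dist s (p.getVert (gateIdx p s)) + posDist p s P + H) :
    ∃ i < p.length, P = 2 * i ∧ ∃ b, gateIdx p b = i ∧ IsFreeEdge G S 0 (p.getVert i) b := by
  rcases h with hi | @⟨a, c, hac, -, hgate⟩
  · omega
  · refine ⟨_, gateIdx_lt hG.1 hp a, rfl,
      exists_isFreeEdge_of_edgeDist_eq hG hp hac hgate fun s hs => ?_⟩
    have := hd s hs
    have := dist_getVert hG hp s (gateIdx_lt hG.1 hp a).le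
    rw [posDist_two_mul] at *
    omega

lemma exists_config_of_balanced_edges [Finite V] [G.LocallyFinite] (hG : G.IsCactus)
    (hbi : G.IsBiactive S) (hbr : G.IsBranchResolving S) (hp : p.IsCycle)
    (hu : u ∈ G.activeSet S p) (he : EdgeAt p e P H) (hf : EdgeAt p f P' H') (hHH : H' ≤ H)
    (hlt : H < H' + cycDist (2 * p.length) P P')
    (hbal : ∀ s ∈ S, 2 * gateIdx p s ≠ P ∧ 2 * gateIdx p s ≠ P' ∧
      posDist p s P + H = posDist p s P' + H') :
    ∃ (w : V) (q : G.Walk w w), G.IsCanonicalCycle S q ∧ (G.ConfigA S q ∨ G.ConfigE S q) := by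
  obtain ⟨w, q, hq, hlen, hcard, hk, hpos⟩ := exists_isCanonicalCycle_of_balanced hG hbi hp hu
    (he.isLocated hG hp).lt (hf.isLocated hG hp).lt hHH hlt fun s hs => (hbal s hs).2.2
  refine ⟨w, q, hq, ?_⟩
  rcases hHH.lt_or_eq with hH | hH
  · obtain ⟨hodd, i, hP⟩ := he.odd_and_exists_eq_two_mul (by omega)
    obtain ⟨i', hi', hqi, hqj⟩ := hpos i hP
    obtain ⟨l, hl, hlen'⟩ := he.exists_isFreeThread hG hbi hbr hp hP fun s hs => (hbal s hs).1
    refine .inr ⟨hcard, i', hi', ⟨l, hqi ▸ hl, by omega⟩, fun hev => ?_⟩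
    rw [Nat.even_iff] at hev
    rw [Nat.odd_iff] at hodd
    obtain ⟨-, j, hP'⟩ := hf.odd_and_exists_eq_two_mul (by omega)
    obtain ⟨l', hl', -⟩ := hf.exists_isFreeThread hG hbi hbr hp hP' fun s hs => (hbal s hs).2.1
    exact ⟨l', hqj j hP' ▸ hl'⟩
  · exact .inl ⟨hcard, Nat.even_iff.mpr (by omega), by omega⟩

lemma hasFreePair_or_exists_config_of_edgeAt [Finite V] [G.LocallyFinite] (hG : G.IsCactus)
    (hbi : G.IsBiactive S) (hbr : G.IsBranchResolving S) (hp : p.IsCycle)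
    (hu : u ∈ G.activeSet S p) (he : EdgeAt p e P H) (hf : EdgeAt p f P' H') (hPP : P ≠ P')
    (h : ∀ s ∈ S, G.edgeDist s e = G.edgeDist s f) :
    HasFreePair G S 0 ∨ ∃ (w : V) (q : G.Walk w w),
      G.IsCanonicalCycle S q ∧ (G.ConfigA S q ∨ G.ConfigE S q) := by
  wlog hHH : H' ≤ H generalizing e f P H P' H'
  · exact this hf he hPP.symm (fun s hs => (h s hs).symm) (by omega)
  have hloc := he.isLocated hG hp
  have hloc' := hf.isLocated hG hp
  have hS (s : V) (hs : s ∈ S) : 2 * G.edgeDist s e + 1 = 2 * G.edgeDist s f + 1 := by rw [h s hs]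
  refine (hloc.eq_or_balanced hloc' hG hbi hp hS hPP hHH).imp (fun hH => ?_) fun hbal =>
    exists_config_of_balanced_edges hG hbi hbr hp hu he hf hHH hbal.1 hbal.2
  have hpos := cycDist_pos hloc.lt hloc'.lt hPP
  have heq (s : V) (hs : s ∈ S) := hloc.eq_of_height_eq hloc' hG hp hPP hH (hS s hs)
  obtain ⟨i, hi, rfl, b, hb, hfree⟩ := he.exists_isFreeEdge hG hp (by omega)
    fun s hs => (heq s hs).1
  exact hasFreePair_of_posDist hG zero_le_one hp hi hloc'.lt hPP (by simp)
    (fun s hs => (heq s hs).2) hb hfree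

lemma hasFreePair_or_exists_config_of_edgeDist_eq [Finite V] [G.LocallyFinite] (hG : G.IsCactus)
    (hpath : ¬ (G.IsAcyclic ∧ ∀ v, G.degree v ≤ 2)) (hbi : G.IsBiactive S)
    (hbr : G.IsBranchResolving S) (he : e ∈ G.edgeSet) (hf : f ∈ G.edgeSet) (hef : e ≠ f)
    (h : ∀ s ∈ S, G.edgeDist s e = G.edgeDist s f) :
    HasFreePair G S 0 ∨ ∃ (w : V) (q : G.Walk w w),
      G.IsCanonicalCycle S q ∧ (G.ConfigA S q ∨ G.ConfigE S q) := by
  rcases S.eq_empty_or_nonempty with rfl | hS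
  · exact .inl (hasFreePair_empty hbi hpath)
  by_cases! hsep : ∀ (u : V) (p : G.Walk u u), p.IsCycle → u ∈ G.activeSet S p →
      ∀ P H P' H', EdgeAt p e P H → EdgeAt p f P' H' → P = P'
  · have hoff (u : V) (p : G.Walk u u) (hp : p.IsCycle) : e ∉ p.edgeSet ∧ f ∉ p.edgeSet ∧
        ∀ a ∈ e, ∀ c ∈ f, gateIdx p a = gateIdx p c := by
      obtain ⟨w, q, hq, hqe, hw⟩ := exists_start_mem_activeSet hG hbi hp
      obtain ⟨P, H, hP⟩ := exists_edgeAt hG hq he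
      obtain ⟨P', H', hP'⟩ := exists_edgeAt hG hq hf
      have hPP := hsep w q hq hw P H P' H' hP hP'
      have heq : e ∉ q.edgeSet := fun h => hef (hP.eq_of_mem hP' hPP h)
      have hfq : f ∉ q.edgeSet := fun h => hef (hP'.eq_of_mem hP hPP.symm h).symm
      refine ⟨hqe ▸ heq, hqe ▸ hfq, fun a ha c hc => ?_⟩
      rw [gateIdx_eq_iff hG hp, ← hqe, ← gateIdx_eq_iff hG hq]
      have := hP.eq_two_mul_gateIdx heq ha
      have := hP'.eq_two_mul_gateIdx hfq hc
      omega
    have hbe : G.IsBridge e :=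
      (isBridge_iff_forall_cycle_notMem he).mpr fun u p hp => (hoff u p hp).1
    have hbf : G.IsBridge f :=
      (isBridge_iff_forall_cycle_notMem hf).mpr fun u p hp => (hoff u p hp).2.1
    induction e with | h a b =>
    induction f with | h c d =>
    exact .inl (hasFreePair_of_edgeDist_eq hG hS hbe hbf hef h fun u p hp =>
      (hoff u p hp).2.2 a (Sym2.mem_mk_left a b) c (Sym2.mem_mk_left c d))
  · obtain ⟨u, p, hp, hu, P, H, P', H', heP, hfP', hne⟩ := hsep
    exact hasFreePair_or_exists_config_of_edgeAt hG hbi hbr hp hu heP hfP' hne h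

end Separated

/-! ### Obstructions -/

section Obstructions

variable {u : V} {p : G.Walk u u}

lemma HasFreePair.not_isVertexMetricGenerator (hG : G.Connected) (h : HasFreePair G S 1) :
    ¬ G.IsVertexMetricGenerator S := by
  obtain ⟨w, b, c, hbc, hb, hc⟩ := h
  intro hgen
  obtain ⟨s, hs, hd⟩ := hgen b c hbc
  have := hb.2 s hs
  have := hc.2 s hs
  have := dist_le_dist_add_one hG s hb.1
  have := dist_le_dist_add_one hG s hc.1
  omega

lemma HasFreePair.not_isEdgeMetricGenerator (h : HasFreePair G S 0) :
    ¬ G.IsEdgeMetricGenerator S := by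
  obtain ⟨w, b, c, hbc, hb, hc⟩ := h
  intro hgen
  obtain ⟨s, hs, hd⟩ := hgen s(w, b) hb.1 s(w, c) hc.1 fun h => hbc (Sym2.congr_right.mp h)
  have := hb.2 s hs
  have := hc.2 s hs
  rw [edgeDist_mk, edgeDist_mk] at hd
  omega

lemma cycDist_opposite {m k i t : ℕ} (hi : i ≤ k) (hk : k ≤ m) (ht : t = 0 ∨ t = k) :
    cycDist (2 * m) t i + (m - k) = cycDist (2 * m) t (m + k - i) := by
  simp only [cycDist]
  omega

lemma cycDist_opposite_edge {m k i t : ℕ} (hi : i ≤ k) (hk : k ≤ m) (ht : t = 0 ∨ t = k) :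
    cycDist (2 * m + 1) t i + (m - k) =
      min (cycDist (2 * m + 1) t (m + k - i)) (cycDist (2 * m + 1) t (m + k - i + 1)) := by
  simp only [cycDist]
  omega

lemma activeSet_eq_pair_of_encard_eq_two (hp : p.IsCycle) (hu : u ∈ G.activeSet S p)
    (hk : 0 < G.lastActive S p) (hcard : (G.activeSet S p).encard = 2) :
    G.activeSet S p = {u, p.getVert (G.lastActive S p)} := by
  obtain ⟨hlt, hmem⟩ := lastActive_mem hp ⟨u, hu⟩
  have hne : u ≠ p.getVert (G.lastActive S p) := fun he =>
    hk.ne (getVert_inj hp (by omega) hlt (p.getVert_zero.trans he))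
  refine (Set.Finite.eq_of_subset_of_encard_le (Set.toFinite _)
    (Set.pair_subset hu hmem) ?_).symm
  rw [hcard, Set.encard_pair hne]

lemma lastActive_pos (hG : G.IsCactus) (hbi : G.IsBiactive S) (hp : p.IsCycle) :
    0 < G.lastActive S p := by
  obtain ⟨s, hs, hs0⟩ := exists_gateIdx_ne hG hbi hp 0
  exact (Nat.pos_of_ne_zero hs0).trans_le (gateIdx_le_lastActive hG.1 hp hs)

lemma two_mul_lastActive_le_of_encard_eq_two (hG : G.IsCactus) (hbi : G.IsBiactive S)
    (hp : G.IsCanonicalCycle S p) (hcard : (G.activeSet S p).encard = 2) :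
    2 * G.lastActive S p ≤ p.length := by
  obtain ⟨hp, hu, hmin⟩ := hp
  have hk := lastActive_pos hG hbi hp
  have hlt := (lastActive_mem hp ⟨u, hu⟩).1
  have hrev := activeSet_eq_of_edgeSet_eq (S := S) hp hp.reverse p.edgeSet_reverse
  have hle := hmin u p.reverse hp.reverse p.edgeSet_reverse (by rwa [hrev])
  have hlast : G.lastActive S p.reverse = p.length - G.lastActive S p := by
    refine lastActive_eq_of_activeSet_eq_pair hp.reverse (by rw [Walk.length_reverse]; omega) ?_
    rw [hrev, p.getVert_reverse, Nat.sub_sub_self hlt.le]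
    exact activeSet_eq_pair_of_encard_eq_two hp hu hk hcard
  omega

lemma gateIdx_eq_zero_or_eq_lastActive (hG : G.IsCactus) (hbi : G.IsBiactive S)
    (hp : p.IsCycle) (hu : u ∈ G.activeSet S p) (hcard : (G.activeSet S p).encard = 2) {s : V}
    (hs : s ∈ S) : gateIdx p s = 0 ∨ gateIdx p s = G.lastActive S p := by
  have hk := lastActive_pos hG hbi hp
  have hlt := (lastActive_mem hp ⟨u, hu⟩).1
  have hmem := getVert_gateIdx_mem_activeSet hG.1 hp hs
  rw [activeSet_eq_pair_of_encard_eq_two hp hu hk hcard] at hmem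
  have hgate := gateIdx_lt hG.1 hp s
  exact hmem.imp
    (fun h => getVert_inj hp hgate (hk.trans hlt) (h.trans p.getVert_zero.symm))
    (fun h => getVert_inj hp hgate hlt h)

lemma dist_getVert_one_of_configA (hG : G.IsCactus) (hbi : G.IsBiactive S)
    (hp : G.IsCanonicalCycle S p) (h : G.ConfigA S p) {s : V} (hs : s ∈ S) :
    G.dist s (p.getVert 1) = G.dist s (p.getVert (p.length - 1)) := by
  obtain ⟨hcard, hev, hk⟩ := h
  have h3 := hp.1.three_le_length
  have hgate := gateIdx_eq_zero_or_eq_lastActive hG hbi hp.1 hp.2.1 hcard hs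
  rw [Nat.even_iff] at hev
  rw [dist_getVert hG hp.1 s (show 1 ≤ p.length by omega),
    dist_getVert hG hp.1 s (p.length.sub_le 1)]
  simp only [cycDist]
  omega

lemma getVert_one_ne_getVert_length_sub_one (hp : p.IsCycle) :
    p.getVert 1 ≠ p.getVert (p.length - 1) := fun h => by
  have h3 := hp.three_le_length
  have := getVert_inj hp (by omega) (by omega) h
  omega

lemma not_isVertexMetricGenerator_of_configA (hG : G.IsCactus) (hbi : G.IsBiactive S)
    (hp : G.IsCanonicalCycle S p) (h : G.ConfigA S p) : ¬ G.IsVertexMetricGenerator S := by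
  intro hgen
  obtain ⟨s, hs, hd⟩ := hgen _ _ (getVert_one_ne_getVert_length_sub_one hp.1)
  exact hd (dist_getVert_one_of_configA hG hbi hp h hs)

lemma not_isEdgeMetricGenerator_of_configA (hG : G.IsCactus) (hbi : G.IsBiactive S)
    (hp : G.IsCanonicalCycle S p) (h : G.ConfigA S p) : ¬ G.IsEdgeMetricGenerator S := by
  intro hgen
  have hnil := hp.1.not_nil
  obtain ⟨s, hs, hd⟩ := hgen s(u, p.snd) (p.adj_snd hnil) s(u, p.penultimate)
    (p.adj_penultimate hnil).symm
    fun h => getVert_one_ne_getVert_length_sub_one hp.1 (Sym2.congr_right.mp h)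
  rw [edgeDist_mk, edgeDist_mk] at hd
  exact hd (congrArg _ (dist_getVert_one_of_configA hG hbi hp h hs))

variable [G.LocallyFinite]

lemma not_isVertexMetricGenerator_of_configC (hG : G.IsCactus) (hbi : G.IsBiactive S)
    (hp : G.IsCanonicalCycle S p) (h : G.ConfigC S p) : ¬ G.IsVertexMetricGenerator S := by
  obtain ⟨hcard, hev, hk, i, hi, l, hl, hlen⟩ := h
  by_cases hA : G.lastActive S p = p.length / 2
  · exact not_isVertexMetricGenerator_of_configA hG hbi hp ⟨hcard, hev, hA⟩
  obtain ⟨t, ht⟩ : ∃ t, p.length / 2 - G.lastActive S p = t + 1 :=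
    Nat.exists_eq_add_one.mpr (by omega)
  set j := p.length / 2 + G.lastActive S p - i with hj
  have hlt := (lastActive_mem hp.1 ⟨u, hp.2.1⟩).1
  have hpos := lastActive_pos hG hbi hp.1
  intro hgen
  obtain ⟨s, hs, hd⟩ := hgen (threadVertex (p.getVert i) l (t + 1)) (p.getVert j) fun h =>
    threadVertex_notMem_support hl.1 hp.1 (by omega) (h ▸ p.getVert_mem_support j)
  have hgate := gateIdx_eq_zero_or_eq_lastActive hG hbi hp.1 hp.2.1 hcard hs
  have hopp := cycDist_opposite hi hk hgate
  rw [Nat.two_mul_div_two_of_even hev, ← hj] at hopp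
  refine hd ?_
  rw [dist_threadVertex hG.1 hl hs (by omega), dist_getVert hG hp.1 s (show i ≤ p.length by omega),
    dist_getVert hG hp.1 s (show j ≤ p.length by omega)]
  omega

lemma edgeDist_threadVertex (hG : G.Connected) {v : V} {l : List V} (h : G.IsFreeThread S v l)
    {s : V} (hs : s ∈ S) {t : ℕ} (ht : t < l.length) :
    G.edgeDist s s(threadVertex v l t, threadVertex v l (t + 1)) = G.dist s v + t := by
  rw [edgeDist_mk, dist_threadVertex hG h hs ht.le, dist_threadVertex hG h hs ht]
  exact min_eq_left (Nat.le_succ _)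

lemma not_isEdgeMetricGenerator_of_even (hG : G.IsCactus) (hbi : G.IsBiactive S)
    (hp : G.IsCanonicalCycle S p) (hcard : (G.activeSet S p).encard = 2) (hev : Even p.length)
    (hk : G.lastActive S p < p.length / 2) {i : ℕ} (hi : i ≤ G.lastActive S p) {l l' : List V}
    (hl : G.IsFreeThread S (p.getVert i) l) (hlen : p.length / 2 - G.lastActive S p < l.length)
    (hl' : G.IsFreeThread S (p.getVert (p.length / 2 + G.lastActive S p - i)) l') :
    ¬ G.IsEdgeMetricGenerator S := by
  set j := p.length / 2 + G.lastActive S p - i with hj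
  obtain ⟨t, ht⟩ : ∃ t, p.length / 2 - G.lastActive S p = t + 1 :=
    Nat.exists_eq_add_one.mpr (by omega)
  rw [ht] at hlen
  have hpos' := length_pos_of_isThread hl'.1
  have hne : s(threadVertex (p.getVert i) l (t + 1), threadVertex (p.getVert i) l (t + 1 + 1)) ≠
      s(threadVertex (p.getVert j) l' 0, threadVertex (p.getVert j) l' 1) := by
    intro h
    have hmem := h ▸ Sym2.mem_mk_left (threadVertex (p.getVert j) l' 0) _
    rw [threadVertex_zero] at hmem
    rcases Sym2.mem_iff.mp hmem with h | h
    · exact threadVertex_notMem_support hl.1 hp.1 (by omega) (h ▸ p.getVert_mem_support j)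
    · exact threadVertex_notMem_support hl.1 hp.1 hlen (h ▸ p.getVert_mem_support j)
  intro hgen
  obtain ⟨s, hs, hd⟩ := hgen _ (adj_threadVertex hl.1 hlen) _ (adj_threadVertex hl'.1 hpos') hne
  have hopp := cycDist_opposite hi hk.le
    (gateIdx_eq_zero_or_eq_lastActive hG hbi hp.1 hp.2.1 hcard hs)
  rw [Nat.two_mul_div_two_of_even hev, ← hj] at hopp
  refine hd ?_
  rw [edgeDist_threadVertex hG.1 hl hs hlen, edgeDist_threadVertex hG.1 hl' hs hpos',
    dist_getVert hG hp.1 s (show i ≤ p.length by omega),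
    dist_getVert hG hp.1 s (show j ≤ p.length by omega)]
  omega

lemma not_isEdgeMetricGenerator_of_odd (hG : G.IsCactus) (hbi : G.IsBiactive S)
    (hp : G.IsCanonicalCycle S p) (hcard : (G.activeSet S p).encard = 2) (hodd : Odd p.length)
    {i : ℕ} (hi : i ≤ G.lastActive S p) {l : List V} (hl : G.IsFreeThread S (p.getVert i) l)
    (hlen : p.length / 2 - G.lastActive S p < l.length) : ¬ G.IsEdgeMetricGenerator S := by
  have hk := two_mul_lastActive_le_of_encard_eq_two hG hbi hp hcard
  have hpos := lastActive_pos hG hbi hp.1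
  have hlen' := Nat.two_mul_div_two_add_one_of_odd hodd
  set t := p.length / 2 - G.lastActive S p with ht
  set j := p.length / 2 + G.lastActive S p - i with hj
  have hne : s(threadVertex (p.getVert i) l t, threadVertex (p.getVert i) l (t + 1)) ≠
      s(p.getVert j, p.getVert (j + 1)) := by
    intro h
    have hmem := h ▸ Sym2.mem_mk_right (threadVertex (p.getVert i) l t) _
    rcases Sym2.mem_iff.mp hmem with h | h <;>
      exact threadVertex_notMem_support hl.1 hp.1 hlen (h ▸ p.getVert_mem_support _)
  intro hgen
  obtain ⟨s, hs, hd⟩ := hgen _ (adj_threadVertex hl.1 hlen) _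
    (p.adj_getVert_succ (show j < p.length by omega)) hne
  have hopp := cycDist_opposite_edge hi (show _ ≤ p.length / 2 by omega)
    (gateIdx_eq_zero_or_eq_lastActive hG hbi hp.1 hp.2.1 hcard hs)
  rw [hlen', ← ht, ← hj] at hopp
  refine hd ?_
  rw [edgeDist_threadVertex hG.1 hl hs hlen, edgeDist_mk,
    dist_getVert hG hp.1 s (show i ≤ p.length by omega),
    dist_getVert hG hp.1 s (show j ≤ p.length by omega),
    dist_getVert hG hp.1 s (show j + 1 ≤ p.length by omega)]
  omega

lemma not_isEdgeMetricGenerator_of_configE (hG : G.IsCactus) (hbi : G.IsBiactive S)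
    (hp : G.IsCanonicalCycle S p) (h : G.ConfigE S p) : ¬ G.IsEdgeMetricGenerator S := by
  obtain ⟨hcard, i, hi, ⟨l, hl, hlen⟩, hthread⟩ := h
  have hk := two_mul_lastActive_le_of_encard_eq_two hG hbi hp hcard
  rcases p.length.even_or_odd with hev | hodd
  · by_cases hA : G.lastActive S p = p.length / 2
    · exact not_isEdgeMetricGenerator_of_configA hG hbi hp ⟨hcard, hev, hA⟩
    obtain ⟨l', hl'⟩ := hthread hev
    exact not_isEdgeMetricGenerator_of_even hG hbi hp hcard hev (by omega) hi hl (by omega) hl'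
  · exact not_isEdgeMetricGenerator_of_odd hG hbi hp hcard hodd hi hl (by omega)

end Obstructions

/-! ### Characterisations -/

section Characterisation

variable [Finite V] [G.LocallyFinite]

theorem hasFreePair_iff (hG : G.IsCactus) (hpath : ¬ (G.IsAcyclic ∧ ∀ v, G.degree v ≤ 2))
    (hbi : G.IsBiactive S) (hbr : G.IsBranchResolving S) (hκ : κ ≤ 1) :
    HasFreePair G S κ ↔
      (∃ (u : V) (p : G.Walk u u), G.IsCanonicalCycle S p ∧ ConfigThread G S κ p) ∨
      ∃ (u w : V) (p : G.Walk u u) (q : G.Walk w w),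
        p.IsCycle ∧ q.IsCycle ∧ CriticallyIncident G S κ p q := by
  refine ⟨exists_configThread_or_criticallyIncident hG hpath hbi hbr hκ, ?_⟩
  rintro (⟨u, p, hp, h⟩ | ⟨u, w, p, q, hp, hq, h⟩)
  · exact hasFreePair_of_configThread hG hκ hp.1 h
  · exact hasFreePair_of_criticallyIncident hG hbi hκ hp hq h

theorem not_isVertexMetricGenerator_iff (hG : G.IsCactus)
    (hpath : ¬ (G.IsAcyclic ∧ ∀ v, G.degree v ≤ 2)) (hbi : G.IsBiactive S)
    (hbr : G.IsBranchResolving S) :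
    ¬ G.IsVertexMetricGenerator S ↔ HasFreePair G S 1 ∨ ∃ (u : V) (p : G.Walk u u),
      G.IsCanonicalCycle S p ∧ (G.ConfigA S p ∨ G.ConfigC S p) := by
  constructor
  · intro hgen
    simp only [IsVertexMetricGenerator, not_forall, not_exists, not_and, not_not] at hgen
    obtain ⟨x, x', hne, h⟩ := hgen
    exact hasFreePair_or_exists_config_of_dist_eq hG hpath hbi hbr hne h
  · rintro (h | ⟨u, p, hp, h | h⟩)
    · exact h.not_isVertexMetricGenerator hG.1
    · exact not_isVertexMetricGenerator_of_configA hG hbi hp h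
    · exact not_isVertexMetricGenerator_of_configC hG hbi hp h

theorem not_isEdgeMetricGenerator_iff (hG : G.IsCactus)
    (hpath : ¬ (G.IsAcyclic ∧ ∀ v, G.degree v ≤ 2)) (hbi : G.IsBiactive S)
    (hbr : G.IsBranchResolving S) :
    ¬ G.IsEdgeMetricGenerator S ↔ HasFreePair G S 0 ∨ ∃ (u : V) (p : G.Walk u u),
      G.IsCanonicalCycle S p ∧ (G.ConfigA S p ∨ G.ConfigE S p) := by
  constructor
  · intro hgen
    simp only [IsEdgeMetricGenerator, not_forall, not_exists, not_and, not_not] at hgen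
    obtain ⟨e, he, f, hf, hef, h⟩ := hgen
    exact hasFreePair_or_exists_config_of_edgeDist_eq hG hpath hbi hbr he hf hef h
  · rintro (h | ⟨u, p, hp, h | h⟩)
    · exact h.not_isEdgeMetricGenerator
    · exact not_isEdgeMetricGenerator_of_configA hG hbi hp h
    · exact not_isEdgeMetricGenerator_of_configE hG hbi hp h

end Characterisation

end Cactus

theorem theorem3 {V : Type*} [Fintype V] (G : SimpleGraph V) [DecidableRel G.Adj]
    (hG : G.IsCactus)
    -- `G` is not a path
    (hpath : ¬ (G.IsAcyclic ∧ ∀ v, G.degree v ≤ 2))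
    (S : Set V) (hbi : G.IsBiactive S) (hbr : G.IsBranchResolving S) :
    (G.IsVertexMetricGenerator S ↔
      (∀ (u : V) (p : G.Walk u u), G.IsCanonicalCycle S p →
        ¬ G.ConfigA S p ∧ ¬ G.ConfigB S p ∧ ¬ G.ConfigC S p) ∧
      (∀ (u w : V) (p : G.Walk u u) (q : G.Walk w w), p.IsCycle → q.IsCycle →
        ¬ G.VertexCriticallyIncident S p q)) ∧
    (G.IsEdgeMetricGenerator S ↔
      (∀ (u : V) (p : G.Walk u u), G.IsCanonicalCycle S p →
        ¬ G.ConfigA S p ∧ ¬ G.ConfigD S p ∧ ¬ G.ConfigE S p) ∧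
      (∀ (u w : V) (p : G.Walk u u) (q : G.Walk w w), p.IsCycle → q.IsCycle →
        ¬ G.EdgeCriticallyIncident S p q)) := by
  open Cactus in
  constructor
  · rw [← not_iff_not, not_isVertexMetricGenerator_iff hG hpath hbi hbr,
      hasFreePair_iff hG hpath hbi hbr le_rfl]
    simp only [configB_iff, vertexCriticallyIncident_iff]
    grind
  · rw [← not_iff_not, not_isEdgeMetricGenerator_iff hG hpath hbi hbr,
      hasFreePair_iff hG hpath hbi hbr zero_le_one]
    simp only [configD_iff, edgeCriticallyIncident_iff]
    grind
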